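/- Let $\mathbb K\in\{\mathbb R,\mathbb C\}$. A Schauder basis $(e_i)_{i\in\mathbb N}$ of a Banach space is called symmetric if, for every permutation $\pi$ of $\mathbb N$ and all scalars $(a_i)$, the series $\sum_i a_i e_{\pi(i)}$ converges if and only if $\sum_i a_i e_i$ converges. For a bounded linear operator $T$ on a Banach space $X$ over $\mathbb K$, put $A_T=\{x\in X:\|T^n x\|\to\infty\}$. Say that $X$ has property $(\ast)$ if there is a bounded linear operator $R:X\to X$ such that $A_R$ is non-empty and nowhere dense in $X$ and such that, for every $x\in X\setminus A_R$, some subsequence of $(R^n x)_{n\ge 1}$ converges weakly to $x$. 1. Every infinite-dimensional Banach space over $\mathbb K$ with a symmetric basis has property $(\ast)$. 2. More generally, every Banach space over $\mathbb K$ that contains an infinite-dimensional complemented subspace with a symmetric basis (that is, the range of a bounded projection) has property $(\ast)$. 3. In particular, every Banach space over $\mathbb K$ that contains a complemented subspace isomorphic to $c_0$ or to $\ell_p$ for some $1\le p<\infty$ (for instance $c_0$ and $\ell_p$ themselves) has property $(\ast)$. 4. Consequently Prăjitură's conjecture, that for every bounded linear operator $T$ on a Banach space over $\mathbb K$ the set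 $A_T$ is norm-dense whenever it is non-empty, is false, both for $\mathbb K=\mathbb R$ and for $\mathbb K=\mathbb C$. -/

import Mathlib

open Filter Topology
open scoped ENNReal ZeroAtInfty

universe u v

/-- A Schauder basis `(e i)`, `i : ℕ`, is *symmetric* if for every permutation `π` of `ℕ` the
sequence `(e (π i))` is equivalent to `(e i)`: for all scalars `a i`, the series `∑ a i • e (π i)`
converges if and only if `∑ a i • e i` does. Here convergence of a series is convergence of its
sequence of partial sums (the summation filter `SummationFilter.conditional ℕ`). -/
def SchauderBasis.IsSymmetric {𝕜 : Type u} {X : Type v} [RCLike 𝕜] [NormedAddCommGroup X]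
    [NormedSpace 𝕜 X] (e : SchauderBasis 𝕜 X) : Prop :=
  ∀ (π : Equiv.Perm ℕ) (a : ℕ → 𝕜),
    Summable (fun i => a i • e.basis (π i)) (SummationFilter.conditional ℕ) ↔
      Summable (fun i => a i • e.basis i) (SummationFilter.conditional ℕ)

/-- `X` has a symmetric (Schauder) basis. The basis is indexed by `ℕ` and linearly independent, so
such an `X` is infinite-dimensional. -/
def HasSymmetricBasis (𝕜 : Type u) (X : Type v) [RCLike 𝕜] [NormedAddCommGroup X]
    [NormedSpace 𝕜 X] : Prop :=
  ∃ e : SchauderBasis 𝕜 X, SchauderBasis.IsSymmetric e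

/-- The set `A_T` of all `x` with `‖T ^ n x‖ → ∞`. -/
def escapingSet {𝕜 : Type u} {X : Type v} [RCLike 𝕜] [NormedAddCommGroup X] [NormedSpace 𝕜 X]
    (T : X →L[𝕜] X) : Set X :=
  {x | Tendsto (fun n : ℕ => ‖(T ^ n) x‖) atTop atTop}

/-- Some subsequence of `(T ^ n x)` converges weakly to `x`. -/
def IsWeaklyRecurrent {𝕜 : Type u} {X : Type v} [RCLike 𝕜] [NormedAddCommGroup X]
    [NormedSpace 𝕜 X] (T : X →L[𝕜] X) (x : X) : Prop :=
  ∃ φ : ℕ → ℕ, StrictMono φ ∧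
    Tendsto (fun k => toWeakSpace 𝕜 X ((T ^ φ k) x)) atTop (𝓝 (toWeakSpace 𝕜 X x))

/-- `X` admits a bounded operator `R` such that `A_R` is non-empty and nowhere dense, and such that
for every `x` outside `A_R` some subsequence of `(R ^ n x)` converges weakly to `x`. -/
def AdmitsMachineOperator (𝕜 : Type u) (X : Type v) [RCLike 𝕜] [NormedAddCommGroup X]
    [NormedSpace 𝕜 X] : Prop :=
  ∃ R : X →L[𝕜] X, (escapingSet R).Nonempty ∧ IsNowhereDense (escapingSet R) ∧
    ∀ x, x ∉ escapingSet R → IsWeaklyRecurrent R x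

/-- Prăjitură's conjecture over the scalar field `𝕜`: for every bounded operator `T` on a Banach
space, `A_T` is norm-dense whenever it is non-empty. -/
def PrajituraConjecture (𝕜 : Type u) [RCLike 𝕜] : Prop :=
  ∀ (X : Type u) [NormedAddCommGroup X] [NormedSpace 𝕜 X] [CompleteSpace X] (T : X →L[𝕜] X),
    (escapingSet T).Nonempty → Dense (escapingSet T)

/-! Pair up the basis vectors as `(u k, v k)` and let `U` rotate the `k`-th pair by `2π / m k`,
where `m 0 = 1` and `m k` is a very fast growing divisibility chain. Then `U` is power bounded,
fixes pair `0`, and `U ^ m k → 1` strongly. Perturb it by `K x = ∑ (w k / m k) (f₀ x - c k g₀ x) u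
(k + 1)`, with `f₀, g₀` the coordinates on pair `0`. Since `K U = K` and `K² = 0`, `(U + K) ^ n = U
^ n + (∑_{i<n} U ^ i) K`, so pair `k + 1` is displaced by `(w k / m k) (f₀ x - c k g₀ x)` times a
geometric sum of `m (k + 1)`-th roots of unity.

If `g₀ x = 0 ≠ f₀ x`, then for `m k ≤ n < m (k + 1)` one of the pairs `k + 1`, `k + 2` carries a
displacement of order at least `w j ‖f₀ x‖` with `j ≥ k`, and `w → ∞`: the orbit escapes
(`Machine.mem_escapingSet`). At time `n = m k` the sums on pairs up to `k` vanish, those beyond `k +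
1` are damped by the growth of `m`, and what is left is at most a constant times `w k ‖f₀ x - c k g₀
x‖` (`Machine.norm_pow_sub_le`). The scalars `c k` approximate every scalar faster than `1 / w k`
infinitely often, so for `g₀ x ≠ 0` the orbit returns to `x` along a subsequence, in norm; for `f₀ x
= g₀ x = 0` it does so trivially. Hence `A_R = {g₀ = 0, f₀ ≠ 0}` lies in a closed hyperplane.

The basis must supply uniformly bounded pairwise rotations: bounded multipliers and a bounded swap
inside the pairs. For a symmetric basis these follow from Banach–Steinhaus once unconditionality is
known, which is a Baire category argument on permutations. A complemented subspace passes its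
operator to the whole space by adding the identity on the complement. -/

/-- A sequence with dense span in a normed space over `𝕜` for which real multipliers with entries
in `[-1, 1]` act uniformly boundedly and every permutation acts boundedly on finite linear
combinations. -/
structure IsSymmetricSystem (𝕜 : Type u) {X : Type v} [RCLike 𝕜] [NormedAddCommGroup X]
    [NormedSpace 𝕜 X] (e : ℕ → X) : Prop where
  ne_zero : ∀ i, e i ≠ 0
  dense_span : Dense (Submodule.span 𝕜 (Set.range e) : Set X)
  multiplier : ∃ C : ℝ, ∀ (A : Finset ℕ) (a : ℕ → 𝕜) (t : ℕ → ℝ), (∀ i, |t i| ≤ 1) →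
    ‖∑ i ∈ A, (t i : 𝕜) • a i • e i‖ ≤ C * ‖∑ i ∈ A, a i • e i‖
  perm : ∀ σ : Equiv.Perm ℕ, ∃ C : ℝ, ∀ (A : Finset ℕ) (a : ℕ → 𝕜),
    ‖∑ i ∈ A, a i • e (σ i)‖ ≤ C * ‖∑ i ∈ A, a i • e i‖

/-! ### Bounded rearrangements imply bounded finite sums and multipliers -/

/-- The pairs of mutually inverse self-maps of `ℕ`. -/
def inversePairs : Set ((ℕ → ℕ) × (ℕ → ℕ)) :=
  {g | (∀ i, g.2 (g.1 i) = i) ∧ ∀ i, g.1 (g.2 i) = i}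

/-- Bijections alone do not form a closed subset of `ℕ → ℕ`. Recording the inverse makes the
condition closed, so the permutations become a Polish space, to which Baire's theorem applies. -/
theorem isClosed_inversePairs : IsClosed inversePairs := by
  have key : ∀ i : ℕ, Continuous fun p : (ℕ → ℕ) × (ℕ → ℕ) => p.2 (p.1 i) := by
    intro i
    refine continuous_iff_continuousAt.2 fun p => ?_
    have h1 : ∀ᶠ q : (ℕ → ℕ) × (ℕ → ℕ) in 𝓝 p, q.1 i = p.1 i :=
      ((continuous_apply i).comp continuous_fst).continuousAt.eventually
        (by simp [nhds_discrete] : ∀ᶠ k in 𝓝 (p.1 i), k = p.1 i)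
    have h2 : ContinuousAt (fun q : (ℕ → ℕ) × (ℕ → ℕ) => q.2 (p.1 i)) p := by fun_prop
    refine h2.congr ?_
    filter_upwards [h1] with q hq
    rw [hq]
  have key' : ∀ i : ℕ, Continuous fun p : (ℕ → ℕ) × (ℕ → ℕ) => p.1 (p.2 i) := fun i =>
    (key i).comp continuous_swap
  have : inversePairs = (⋂ i, {p : (ℕ → ℕ) × (ℕ → ℕ) | p.2 (p.1 i) = i}) ∩
      ⋂ i, {p : (ℕ → ℕ) × (ℕ → ℕ) | p.1 (p.2 i) = i} := by
    ext p; simp [inversePairs]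
  rw [this]
  exact (isClosed_iInter fun i => isClosed_eq (key i) continuous_const).inter
    (isClosed_iInter fun i => isClosed_eq (key' i) continuous_const)

/-- Any finite injection extends to a permutation. Here it places `A` right after the first `L`
values of `π`, so that a sum over `A` becomes a block of consecutive terms of a rearrangement. -/
theorem exists_perm_extending (π : Equiv.Perm ℕ) (L : ℕ) (A : Finset ℕ)
    (hA : ∀ i < L, π i ∉ A) :
    ∃ σ : Equiv.Perm ℕ, (∀ i < L, σ i = π i) ∧
      (Finset.Ico L (L + A.card)).image σ = A := by
  classical
  obtain ⟨f⟩ : Nonempty (Fin A.card ≃ A) := ⟨(Fintype.equivFinOfCardEq (by simp)).symm⟩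
  let y : Fin (L + A.card) → ℕ := Fin.append (fun i : Fin L => π i) (fun i => (f i : ℕ))
  have hy : Function.Injective y := by
    rw [Fin.append_injective_iff]
    refine ⟨fun i j h => Fin.ext (π.injective h), fun i j h => f.injective (Subtype.ext h), ?_⟩
    intro i j h
    exact hA i i.2 (h ▸ (f j).2)
  have := (Equiv.Perm.isMultiplyPretransitive ℕ (L + A.card)).exists_smul_eq
    (⟨fun i => (i : ℕ), Fin.val_injective⟩ : Fin (L + A.card) ↪ ℕ) ⟨y, hy⟩
  obtain ⟨σ, hσ⟩ := this
  have hσ' : ∀ i : Fin (L + A.card), σ (i : ℕ) = y i := fun i => by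
    simpa using! DFunLike.congr_fun hσ i
  have h2 : ∀ j : Fin A.card, σ (L + j) = f j := fun j => by
    have := hσ' (Fin.natAdd L j)
    simpa [y] using this
  refine ⟨σ, fun i hi => ?_, ?_⟩
  · exact (hσ' (Fin.castAdd _ ⟨i, hi⟩)).trans (Fin.append_left _ _ (⟨i, hi⟩ : Fin L))
  · ext a
    simp only [Finset.mem_image, Finset.mem_Ico]
    constructor
    · rintro ⟨i, ⟨h, h'⟩, rfl⟩
      have := h2 ⟨i - L, by omega⟩
      rw [show L + (i - L) = i by omega] at this
      rw [this]; exact (f _).2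
    · intro ha
      refine ⟨L + f.symm ⟨a, ha⟩, ⟨by omega, by have := (f.symm ⟨a, ha⟩).2; omega⟩, ?_⟩
      rw [h2]; simp

/-- If the partial sums of every rearrangement of a series are bounded, then the sums over all
finite sets are uniformly bounded. -/
theorem exists_norm_finset_sum_le_of_perm {X : Type v} [NormedAddCommGroup X] (z : ℕ → X)
    (h : ∀ π : Equiv.Perm ℕ, ∃ M : ℝ, ∀ N, ‖∑ i ∈ Finset.range N, z (π i)‖ ≤ M) :
    ∃ M : ℝ, ∀ A : Finset ℕ, ‖∑ i ∈ A, z i‖ ≤ M := by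
  classical
  have : PolishSpace inversePairs := isClosed_inversePairs.polishSpace
  let S : ℕ → Set inversePairs := fun M =>
    {g | ∀ N, ‖∑ i ∈ Finset.range N, z (g.1.1 i)‖ ≤ M}
  have hS : ∀ M, IsClosed (S M) := by
    intro M
    have : S M = ⋂ N, {g : inversePairs | ‖∑ i ∈ Finset.range N, z (g.1.1 i)‖ ≤ M} := by
      ext g; simp [S]
    rw [this]
    refine isClosed_iInter fun N => isClosed_le ?_ continuous_const
    refine continuous_norm.comp (continuous_finsetSum _ fun i _ => ?_)
    exact (continuous_of_discreteTopology (f := z)).comp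
      ((continuous_apply i).comp (continuous_fst.comp continuous_subtype_val))
  have hU : ⋃ M, S M = Set.univ := by
    refine Set.eq_univ_of_forall fun g => ?_
    obtain ⟨M, hM⟩ := h ⟨g.1.1, g.1.2, g.2.1, g.2.2⟩
    obtain ⟨n, hn⟩ := exists_nat_ge M
    exact Set.mem_iUnion.2 ⟨n, fun N => (hM N).trans hn⟩
  have : Nonempty inversePairs := ⟨⟨(id, id), by simp [inversePairs]⟩⟩
  obtain ⟨M, g, hg⟩ := nonempty_interior_of_iUnion_of_closed hS hU
  rw [mem_interior_iff_mem_nhds, nhds_subtype, Filter.mem_comap] at hg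
  obtain ⟨V, hV, hVS⟩ := hg
  obtain ⟨V1, hV1, V2, hV2, hV12⟩ := mem_nhds_prod_iff.1 hV
  have agree : ∀ (q : ℕ → ℕ) (W : Set (ℕ → ℕ)), W ∈ 𝓝 q → ∃ n, ∀ r : ℕ → ℕ,
      (∀ i < n, r i = q i) → r ∈ W := by
    intro q W hW
    rw [nhds_pi, Filter.mem_pi] at hW
    obtain ⟨I, hI, t, ht, hsub⟩ := hW
    obtain ⟨n, hn⟩ := hI.bddAbove
    refine ⟨n + 1, fun r hr => hsub fun i hi => ?_⟩
    rw [hr i (Nat.lt_succ_of_le (hn hi))]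
    exact mem_of_mem_nhds (ht i)
  obtain ⟨n1, h1⟩ := agree _ _ hV1
  obtain ⟨n2, h2⟩ := agree _ _ hV2
  let π : Equiv.Perm ℕ := ⟨g.1.1, g.1.2, g.2.1, g.2.2⟩
  -- Agreement with `π` below `L` must also force agreement of the inverses below `n2`, so `L` has
  -- to exceed the `π`-preimages of these integers.
  obtain ⟨L, hL1, hL2⟩ : ∃ L, n1 ≤ L ∧ ∀ j < n2, π.symm j < L := by
    obtain ⟨L, hL⟩ := (Set.finite_lt_nat n2).image π.symm |>.bddAbove
    refine ⟨max n1 (L + 1), le_max_left _ _, fun j hj => ?_⟩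
    exact lt_max_of_lt_right (Nat.lt_succ_of_le (hL ⟨j, hj, rfl⟩))
  have good : ∀ σ : Equiv.Perm ℕ, (∀ i < L, σ i = π i) →
      ∀ N, ‖∑ i ∈ Finset.range N, z (σ i)‖ ≤ M := by
    intro σ hσ
    have : (⟨(σ, σ.symm), by simp [inversePairs]⟩ : inversePairs) ∈ S M := by
      apply hVS
      apply hV12
      refine ⟨h1 _ fun i hi => hσ i (hi.trans_le hL1), h2 _ fun j hj => ?_⟩
      have := hσ _ (hL2 j hj)
      rw [Equiv.apply_symm_apply] at this
      change σ.symm j = π.symm j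
      rw [Equiv.symm_apply_eq, this]
    exact this
  let B := (Finset.range L).image π
  have bound : ∀ A : Finset ℕ, Disjoint A B → ‖∑ i ∈ A, z i‖ ≤ 2 * M := by
    intro A hAB
    obtain ⟨σ, hσ, hσA⟩ := exists_perm_extending π L A fun i hi hmem =>
      Finset.disjoint_left.1 hAB hmem (Finset.mem_image.2 ⟨i, by simpa using hi, rfl⟩)
    have e1 : ∑ i ∈ A, z i = ∑ i ∈ Finset.Ico L (L + A.card), z (σ i) := by
      conv_lhs => rw [← hσA]
      exact Finset.sum_image fun i _ j _ h => σ.injective h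
    -- The block is a difference of two initial sums of the same rearrangement, each bounded by `M`.
    rw [e1, Finset.sum_Ico_eq_sub _ (Nat.le_add_right _ _)]
    calc _ ≤ _ := norm_sub_le _ _
      _ ≤ (M : ℝ) + M := add_le_add (good σ hσ _) (good σ hσ _)
      _ = 2 * M := by ring
  refine ⟨2 * M + ∑ i ∈ B, ‖z i‖, fun A => ?_⟩
  rw [← Finset.sum_sdiff (Finset.inter_subset_left : A ∩ B ⊆ A)]
  refine (norm_add_le _ _).trans (add_le_add (bound _ ?_) ?_)
  · rw [Finset.sdiff_inter_self_left]; exact Finset.sdiff_disjoint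
  · exact (norm_sum_le _ _).trans (Finset.sum_le_sum_of_subset_of_nonneg
      Finset.inter_subset_right fun _ _ _ => norm_nonneg _)

theorem summable_conditional_iff {X : Type v} [AddCommMonoid X] [TopologicalSpace X] {z : ℕ → X} :
    Summable z (SummationFilter.conditional ℕ) ↔
      ∃ x, Tendsto (fun N => ∑ i ∈ Finset.range N, z i) atTop (𝓝 x) := by
  simp only [Summable, HasSum, SummationFilter.conditional_filter_eq_map_range,
    Filter.tendsto_map'_iff]
  rfl

/-- Uniform boundedness of all finite partial sums in a Banach space gives a uniform bound for
real multipliers with entries in `[-1, 1]`. -/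
theorem norm_sum_real_smul_le {𝕜 : Type u} {X : Type v} [RCLike 𝕜] [NormedAddCommGroup X]
    [NormedSpace 𝕜 X] (z : ℕ → X) (A : Finset ℕ) (t : ℕ → ℝ) (ht : ∀ i, |t i| ≤ 1) (M : ℝ)
    (hM : ∀ B ⊆ A, ‖∑ i ∈ B, z i‖ ≤ M) :
    ‖∑ i ∈ A, (t i : 𝕜) • z i‖ ≤ 2 * M := by
  classical
  -- A norming functional reduces the bound to real scalars; splitting them by sign costs the factor
  -- `2`.
  obtain ⟨g, hg, hgx⟩ := exists_dual_vector'' 𝕜 (∑ i ∈ A, (t i : 𝕜) • z i)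
  have hre : ‖∑ i ∈ A, (t i : 𝕜) • z i‖ = ∑ i ∈ A, t i * RCLike.re (g (z i)) := by
    have := congrArg RCLike.re hgx
    rw [RCLike.ofReal_re] at this
    rw [← this, map_sum, map_sum]
    refine Finset.sum_congr rfl fun i _ => ?_
    rw [map_smul, smul_eq_mul, RCLike.re_ofReal_mul]
  have hB : ∀ B ⊆ A, |∑ i ∈ B, RCLike.re (g (z i))| ≤ M := by
    intro B hBA
    rw [← map_sum, ← map_sum]
    calc _ ≤ ‖g (∑ i ∈ B, z i)‖ := RCLike.abs_re_le_norm _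
      _ ≤ ‖g‖ * ‖∑ i ∈ B, z i‖ := g.le_opNorm _
      _ ≤ 1 * ‖∑ i ∈ B, z i‖ := by gcongr
      _ ≤ M := by rw [one_mul]; exact hM B hBA
  rw [hre]
  calc ∑ i ∈ A, t i * RCLike.re (g (z i)) ≤ ∑ i ∈ A, |RCLike.re (g (z i))| := by
        refine Finset.sum_le_sum fun i _ => (le_abs_self _).trans ?_
        rw [abs_mul]
        exact mul_le_of_le_one_left (abs_nonneg _) (ht i)
    _ = ∑ i ∈ A with 0 ≤ RCLike.re (g (z i)), RCLike.re (g (z i)) -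
        ∑ i ∈ A with ¬ 0 ≤ RCLike.re (g (z i)), RCLike.re (g (z i)) := by
        rw [← Finset.sum_filter_add_sum_filter_not A (fun i => 0 ≤ RCLike.re (g (z i))),
          sub_eq_add_neg, ← Finset.sum_neg_distrib]
        refine congrArg₂ _ (Finset.sum_congr rfl fun i hi => ?_)
          (Finset.sum_congr rfl fun i hi => ?_)
        · exact abs_of_nonneg (Finset.mem_filter.1 hi).2
        · exact abs_of_neg (not_le.1 (Finset.mem_filter.1 hi).2)
    _ ≤ 2 * M := by
        have h1 := (abs_le.1 (hB _ (Finset.filter_subset (fun i => 0 ≤ RCLike.re (g (z i))) A))).2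
        have h2 := (abs_le.1 (hB _ (Finset.filter_subset
          (fun i => ¬ 0 ≤ RCLike.re (g (z i))) A))).1
        linarith

/-! ### From symmetric bases to bounded multipliers and permutations -/

section SymmetricBasis

variable {𝕜 : Type u} {X : Type v} [RCLike 𝕜] [NormedAddCommGroup X] [NormedSpace 𝕜 X]

theorem SchauderBasis.coord_sum_finset (e : SchauderBasis 𝕜 X) (A : Finset ℕ) (a : ℕ → 𝕜) (j : ℕ) :
    e.coord j (∑ i ∈ A, a i • e.basis i) = if j ∈ A then a j else 0 := by
  simp [map_sum, e.ortho, Pi.single_apply]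

theorem SchauderBasis.IsSymmetric.summable_coord {e : SchauderBasis 𝕜 X} (he : e.IsSymmetric)
    (π : Equiv.Perm ℕ) (x : X) :
    Summable (fun i => e.coord i x • e.basis (π i)) (SummationFilter.conditional ℕ) :=
  (he π _).2 (e.expansion x).summable

/-- Symmetry moves the vectors but not the coefficients. Applying it with `π⁻¹` gives a vector whose
`j`-th coordinate is the `π j`-th coordinate of `x`; applying it to that vector with `π` gives the
rearranged expansion. -/
theorem SchauderBasis.IsSymmetric.summable_rearrangement {e : SchauderBasis 𝕜 X}
    (he : e.IsSymmetric) (π : Equiv.Perm ℕ) (x : X) :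
    Summable (fun i => e.coord (π i) x • e.basis (π i)) (SummationFilter.conditional ℕ) := by
  obtain ⟨y, hy⟩ := he.summable_coord π.symm x
  have hc : ∀ j, e.coord j y = e.coord (π j) x := by
    intro j
    have h1 : HasSum (fun i => e.coord j (e.coord i x • e.basis (π.symm i))) (e.coord j y)
      (SummationFilter.conditional ℕ) := hy.map (e.coord j) (e.coord j).continuous
    have h2 : HasSum (fun i => e.coord j (e.coord i x • e.basis (π.symm i)))
        (e.coord j (e.coord (π j) x • e.basis (π.symm (π j))))
        (SummationFilter.conditional ℕ) := by
      refine hasSum_single (π j) (fun i hi => ?_) _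
      have : π.symm i ≠ j := fun h => hi (by rw [← h, Equiv.apply_symm_apply])
      simp [e.ortho, this.symm]
    rw [h1.unique h2]
    simp [e.ortho]
  have := he.summable_coord π y
  simpa only [hc] using this

theorem SchauderBasis.IsSymmetric.isSymmetricSystem [CompleteSpace X] {e : SchauderBasis 𝕜 X}
    (he : e.IsSymmetric) : IsSymmetricSystem 𝕜 e.basis where
  ne_zero i hi := by
    have := e.ortho i i
    simp [hi] at this
  dense_span x := by
    have h : Tendsto (fun A => ∑ i ∈ A, e.coord i x • e.basis i)
      (SummationFilter.conditional ℕ).filter (𝓝 x) := e.expansion x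
    exact mem_closure_of_tendsto h (Eventually.of_forall fun A =>
      Submodule.sum_mem _ fun i _ => Submodule.smul_mem _ _ (Submodule.subset_span ⟨i, rfl⟩))
  multiplier := by
    classical
    obtain ⟨K, hK⟩ : ∃ K, ∀ A : Finset ℕ, ‖GeneralSchauderBasis.proj e A‖ ≤ K := by
      apply banach_steinhaus
      intro x
      simp only [GeneralSchauderBasis.proj_apply]
      refine exists_norm_finset_sum_le_of_perm (fun i => e.coord i x • e.basis i) fun π => ?_
      obtain ⟨y, hy⟩ := summable_conditional_iff.1 (he.summable_rearrangement π x)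
      obtain ⟨M, hM⟩ := hy.norm.bddAbove_range
      exact ⟨M, fun N => hM ⟨N, rfl⟩⟩
    refine ⟨2 * K, fun A a t ht => ?_⟩
    rw [mul_assoc]
    refine norm_sum_real_smul_le (fun i => a i • e.basis i) A t ht _ fun B hB => ?_
    have : ∑ i ∈ B, a i • e.basis i = GeneralSchauderBasis.proj e B (∑ i ∈ A, a i • e.basis i) := by
      rw [GeneralSchauderBasis.proj_apply]
      refine Finset.sum_congr rfl fun i hi => ?_
      rw [SchauderBasis.coord_sum_finset, if_pos (hB hi)]
    rw [this]
    exact (GeneralSchauderBasis.proj e B).le_of_opNorm_le (hK B) _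
  perm σ := by
    let T : ℕ → X →L[𝕜] X := fun N => ∑ i ∈ Finset.range N, (e.coord i).smulRight (e.basis (σ i))
    have hT : ∀ N x, T N x = ∑ i ∈ Finset.range N, e.coord i x • e.basis (σ i) := fun N x => by
      simp [T]
    obtain ⟨C, hC⟩ : ∃ C, ∀ N, ‖T N‖ ≤ C := by
      apply banach_steinhaus
      intro x
      obtain ⟨y, hy⟩ := summable_conditional_iff.1 (he.summable_coord σ x)
      obtain ⟨M, hM⟩ := hy.norm.bddAbove_range
      exact ⟨M, fun N => by rw [hT]; exact hM ⟨N, rfl⟩⟩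
    refine ⟨C, fun A a => ?_⟩
    obtain ⟨N, hN⟩ := A.exists_nat_subset_range
    have : ∑ i ∈ A, a i • e.basis (σ i) = T N (∑ i ∈ A, a i • e.basis i) := by
      rw [hT]
      simp only [SchauderBasis.coord_sum_finset, ite_smul, zero_smul, Finset.sum_ite_mem]
      rw [Finset.inter_eq_right.2 hN]
    rw [this]
    exact (T N).le_of_opNorm_le (hC N) _

end SymmetricBasis

/-! ### Scalars approximating every scalar against a divergent weight -/

/-- A sequence `c` of scalars which approximates every scalar faster than `1 / w` infinitely often,
where `w` tends to infinity. -/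
theorem exists_frequently_mul_norm_sub_lt (𝕜 : Type u) [RCLike 𝕜] :
    ∃ (c : ℕ → 𝕜) (w : ℕ → ℕ), Tendsto w atTop atTop ∧
      ∀ z : 𝕜, ∀ ε > 0, ∃ᶠ k in atTop, (w k : ℝ) * ‖z - c k‖ < ε := by
  -- Level `N` is a finite `(N + 1)⁻²`-net of the ball of radius `N` and gets weight `N`. Listing
  -- all levels, the weight tends to infinity because each level is finite, while weight times mesh
  -- tends to zero.
  have hnet : ∀ N : ℕ, ∃ s : Finset 𝕜, s.Nonempty ∧
      ∀ z : 𝕜, ‖z‖ ≤ N → ∃ y ∈ s, ‖z - y‖ < 1 / ((N : ℝ) + 1) ^ 2 := by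
    intro N
    obtain ⟨t, -, ht, hcov⟩ := (isCompact_closedBall (0 : 𝕜) (N : ℝ)).finite_cover_balls
      (e := 1 / ((N : ℝ) + 1) ^ 2) (by positivity)
    have hcov' : ∀ z : 𝕜, ‖z‖ ≤ N → ∃ y ∈ ht.toFinset, ‖z - y‖ < 1 / ((N : ℝ) + 1) ^ 2 := by
      intro z hz
      have := hcov (mem_closedBall_zero_iff.2 hz)
      simpa [dist_eq_norm] using this
    refine ⟨ht.toFinset, ?_, hcov'⟩
    obtain ⟨y, hy, -⟩ := hcov' 0 (by simp)
    exact ⟨y, hy⟩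
  choose s hs hcov using hnet
  have hinf : Infinite (Σ N, s N) := by
    choose y hy using hs
    exact Infinite.of_injective (fun N => ⟨N, y N, hy N⟩) fun a b h => (Sigma.mk.inj_iff.1 h).1
  obtain ⟨F⟩ : Nonempty (ℕ ≃ Σ N, s N) := nonempty_equiv_of_countable
  refine ⟨fun k => (F k).2, fun k => (F k).1, ?_, ?_⟩
  · rw [← Nat.cofinite_eq_atTop]
    refine Tendsto.comp (y := cofinite) ?_ F.injective.tendsto_cofinite
    refine Filter.Tendsto.cofinite_of_finite_preimage_singleton fun N => ?_
    have : (Sigma.fst ⁻¹' {N} : Set (Σ N, s N)) = Set.range (Sigma.mk N) := by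
      ext ⟨a, b⟩
      constructor
      · rintro rfl; exact ⟨b, rfl⟩
      · rintro ⟨b, h⟩; exact (Sigma.mk.inj_iff.1 h).1.symm
    rw [this]
    exact Set.finite_range _
  · intro z ε hε
    obtain ⟨N0, hN0⟩ := exists_nat_ge (max ‖z‖ (1 / ε))
    have hy : ∀ N : ℕ, ∃ k : ℕ, (F k).1 = N + N0 ∧
        ‖z - (F k).2‖ < 1 / (((N + N0 : ℕ) : ℝ) + 1) ^ 2 := by
      intro N
      obtain ⟨y, hy, hz⟩ := hcov (N + N0) z
        (((le_max_left _ _).trans hN0).trans (by push_cast; linarith [(Nat.cast_nonneg N : (0:ℝ) ≤ N)]))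
      refine ⟨F.symm ⟨N + N0, y, hy⟩, by rw [Equiv.apply_symm_apply], ?_⟩
      rw [Equiv.apply_symm_apply]
      exact hz
    choose k hk1 hk2 using hy
    have hinj : Function.Injective k := fun a b h => by
      have := hk1 a
      rw [h, hk1 b] at this
      omega
    have := hinj.nat_tendsto_atTop.frequently (p := fun k => ((F k).1 : ℝ) * ‖z - (F k).2‖ < ε)
    refine this (Eventually.frequently (Eventually.of_forall fun N => ?_))
    have h0 : 1 / ε ≤ (N + N0 : ℕ) := ((le_max_right _ _).trans hN0).trans
      (by push_cast; linarith [(Nat.cast_nonneg N : (0:ℝ) ≤ N)])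
    have hw : ((F (k N)).1 : ℝ) = ((N + N0 : ℕ) : ℝ) := congrArg Nat.cast (hk1 N)
    refine lt_of_eq_of_lt (congrArg (fun r : ℝ => r * ‖z - (F (k N)).2‖) hw) ?_
    have hz := (hk2 N).le
    set L : ℝ := ((N + N0 : ℕ) : ℝ)
    have hL : 0 < L := (by positivity : (0:ℝ) < 1 / ε).trans_le h0
    calc L * ‖z - (F (k N)).2‖ ≤ L * (1 / (L + 1) ^ 2) := by gcongr
      _ < 1 / L := by
        rw [mul_one_div, div_lt_div_iff₀ (by positivity) hL]
        nlinarith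
      _ ≤ ε := by
        rw [div_le_iff₀ hL]
        rwa [div_le_iff₀ hε, mul_comm] at h0

/-! ### Geometric sums of roots of unity, and divisibility chains -/

theorem sin_mul_sum_cos (φ : ℝ) (n : ℕ) :
    Real.sin φ * ∑ i ∈ Finset.range n, Real.cos (i * (2 * φ)) =
      Real.sin (n * φ) * Real.cos ((n - 1) * φ) := by
  induction n with
  | zero => simp
  | succ n ih =>
    rw [Finset.sum_range_succ, mul_add, ih]
    push_cast
    rw [show ((n : ℝ) + 1 - 1) * φ = n * φ by ring, show ((n : ℝ) + 1) * φ = n * φ + φ by ring,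
      show ((n : ℝ) - 1) * φ = n * φ - φ by ring, show (n : ℝ) * (2 * φ) = 2 * (n * φ) by ring,
      Real.sin_add, Real.cos_sub, Real.cos_two_mul]
    linear_combination Real.sin φ * Real.sin_sq_add_cos_sq (n * φ)

theorem sin_mul_sum_sin (φ : ℝ) (n : ℕ) :
    Real.sin φ * ∑ i ∈ Finset.range n, Real.sin (i * (2 * φ)) =
      Real.sin (n * φ) * Real.sin ((n - 1) * φ) := by
  induction n with
  | zero => simp
  | succ n ih =>
    rw [Finset.sum_range_succ, mul_add, ih]
    push_cast
    rw [show ((n : ℝ) + 1 - 1) * φ = n * φ by ring, show ((n : ℝ) + 1) * φ = n * φ + φ by ring,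
      show ((n : ℝ) - 1) * φ = n * φ - φ by ring, show (n : ℝ) * (2 * φ) = 2 * (n * φ) by ring,
      Real.sin_add, Real.sin_sub, Real.sin_two_mul]
    ring

/-- The sum of the cosines of the first `n` multiples of `2π / m`. -/
noncomputable def cosSum (m n : ℕ) : ℝ := ∑ i ∈ Finset.range n, Real.cos (i * (2 * (Real.pi / m)))

/-- The sum of the sines of the first `n` multiples of `2π / m`. -/
noncomputable def sinSum (m n : ℕ) : ℝ := ∑ i ∈ Finset.range n, Real.sin (i * (2 * (Real.pi / m)))

theorem abs_cosSum_le (m n : ℕ) : |cosSum m n| ≤ n := by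
  refine (Finset.abs_sum_le_sum_abs _ _).trans ((Finset.sum_le_sum fun i _ =>
    Real.abs_cos_le_one _).trans ?_)
  simp

theorem abs_sinSum_le (m n : ℕ) : |sinSum m n| ≤ n := by
  refine (Finset.abs_sum_le_sum_abs _ _).trans ((Finset.sum_le_sum fun i _ =>
    Real.abs_sin_le_one _).trans ?_)
  simp

theorem sin_pi_div_pos {m : ℕ} (hm : 2 ≤ m) : 0 < Real.sin (Real.pi / m) := by
  have h2 : (2 : ℝ) ≤ m := by exact_mod_cast hm
  refine Real.sin_pos_of_pos_of_lt_pi (by positivity) ?_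
  rw [div_lt_iff₀ (by linarith)]
  nlinarith [Real.pi_pos]

theorem cosSum_sinSum_eq_zero {m n : ℕ} (hm : 2 ≤ m) (hmn : m ∣ n) :
    cosSum m n = 0 ∧ sinSum m n = 0 := by
  obtain ⟨k, rfl⟩ := hmn
  have hs := sin_pi_div_pos hm
  have h0 : Real.sin (((m * k : ℕ) : ℝ) * (Real.pi / m)) = 0 := by
    rw [show ((m * k : ℕ) : ℝ) * (Real.pi / m) = k * Real.pi by
      have : (m : ℝ) ≠ 0 := by positivity
      push_cast; field_simp]
    exact Real.sin_nat_mul_pi k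
  have h1 := sin_mul_sum_cos (Real.pi / m) (m * k)
  have h2 := sin_mul_sum_sin (Real.pi / m) (m * k)
  rw [h0, zero_mul] at h1 h2
  exact ⟨(mul_eq_zero.1 h1).resolve_left hs.ne', (mul_eq_zero.1 h2).resolve_left hs.ne'⟩

/-- The geometric sum has modulus `|sin (nπ/m)| / sin (π/m)`. As `n` stays at distance `d` from both
`0` and `m`, Jordan's inequality bounds the numerator below by `2d/m`; the denominator is at most
`π/m ≤ 4/m`. -/
theorem le_cosSum_add_sinSum {m n d : ℕ} (hm : 2 ≤ m) (hdn : d ≤ n) (hnd : n + d ≤ m) :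
    (d : ℝ) ≤ 2 * (|cosSum m n| + |sinSum m n|) := by
  have hs := sin_pi_div_pos hm
  have hm0 : (0 : ℝ) < m := by positivity
  have hpi := Real.pi_pos
  have h1 : Real.sin (Real.pi / m) * cosSum m n = _ := sin_mul_sum_cos (Real.pi / m) n
  have h2 : Real.sin (Real.pi / m) * sinSum m n = _ := sin_mul_sum_sin (Real.pi / m) n
  have hdn' : (d : ℝ) ≤ n := by exact_mod_cast hdn
  have hnd' : (n : ℝ) + d ≤ m := by exact_mod_cast hnd
  have hd0 : (0 : ℝ) ≤ d := Nat.cast_nonneg d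
  have hmul : (m : ℝ) * (Real.pi / m) = Real.pi := by field_simp
  have hq : 0 < Real.pi / m := by positivity
  have hlow : 2 * (d : ℝ) / m ≤ Real.sin (n * (Real.pi / m)) := by
    have hdq : (d : ℝ) * (Real.pi / m) ≤ Real.pi / 2 := by nlinarith
    have h3 : 2 * (d : ℝ) / m ≤ Real.sin (d * (Real.pi / m)) := by
      have := Real.mul_le_sin (x := d * (Real.pi / m)) (by positivity) hdq
      refine le_trans (le_of_eq ?_) this
      field_simp
    refine h3.trans ?_
    rcases le_total ((n : ℝ) * (Real.pi / m)) (Real.pi / 2) with h | h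
    · exact Real.sin_le_sin_of_le_of_le_pi_div_two (by nlinarith) h (by gcongr)
    · rw [← Real.sin_pi_sub (n * (Real.pi / m))]
      exact Real.sin_le_sin_of_le_of_le_pi_div_two (by nlinarith) (by linarith) (by nlinarith)
  have hup : Real.sin (Real.pi / m) ≤ 4 / m := by
    refine (Real.sin_le hq.le).trans ?_
    gcongr
    exact Real.pi_le_four
  have hsum : |Real.sin (n * (Real.pi / m))| ≤
      Real.sin (Real.pi / m) * (|cosSum m n| + |sinSum m n|) := by
    have e1 := congrArg abs h1
    have e2 := congrArg abs h2
    rw [abs_mul, abs_mul, abs_of_pos hs] at e1 e2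
    rw [mul_add, e1, e2, ← mul_add]
    refine le_mul_of_one_le_right (abs_nonneg _) ?_
    have := Real.sin_sq_add_cos_sq (((n : ℝ) - 1) * (Real.pi / m))
    have ha := Real.abs_cos_le_one (((n : ℝ) - 1) * (Real.pi / m))
    have hb := Real.abs_sin_le_one (((n : ℝ) - 1) * (Real.pi / m))
    rw [← sq_abs, ← sq_abs (Real.cos _)] at this
    nlinarith [abs_nonneg (Real.cos (((n : ℝ) - 1) * (Real.pi / m))),
      abs_nonneg (Real.sin (((n : ℝ) - 1) * (Real.pi / m)))]
  have hfin : 2 * (d : ℝ) / m ≤ 4 / m * (|cosSum m n| + |sinSum m n|) :=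
    (hlow.trans (le_abs_self _)).trans (hsum.trans (by gcongr))
  rw [div_mul_eq_mul_div, div_le_div_iff_of_pos_right hm0] at hfin
  linarith

/-- A divisibility chain growing as fast as prescribed. -/
theorem exists_dvd_chain (B : ℕ → ℝ) :
    ∃ m : ℕ → ℕ, m 0 = 1 ∧ (∀ k, m k ∣ m (k + 1)) ∧ (∀ k, 4 * m k ≤ m (k + 1)) ∧
      ∀ k, B k * m k ≤ m (k + 1) := by
  refine ⟨fun k => ∏ i ∈ Finset.range k, max 4 ⌈B i⌉₊, by simp, fun k => ?_, fun k => ?_,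
    fun k => ?_⟩
  · simp only
    rw [Finset.prod_range_succ]; exact dvd_mul_right _ _
  · simp only
    rw [Finset.prod_range_succ, mul_comm]
    exact Nat.mul_le_mul_left _ (le_max_left _ _)
  · simp only
    rw [Finset.prod_range_succ, Nat.cast_mul, mul_comm]
    refine mul_le_mul_of_nonneg_left ?_ (Nat.cast_nonneg _)
    exact (Nat.le_ceil _).trans (by exact_mod_cast le_max_right _ _)

/-- A bound on finite linear combinations extends an assignment of vectors on a system with dense
span to a bounded operator. -/
theorem exists_clm_of_norm_sum_le {𝕜 : Type u} {X : Type v} {F : Type*} [RCLike 𝕜]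
    [NormedAddCommGroup X] [NormedSpace 𝕜 X] [NormedAddCommGroup F] [NormedSpace 𝕜 F]
    [CompleteSpace F] {e : ℕ → X} (he : Dense (Submodule.span 𝕜 (Set.range e) : Set X))
    (y : ℕ → F) (C : ℝ) (hC : 0 ≤ C)
    (h : ∀ (A : Finset ℕ) (a : ℕ → 𝕜), ‖∑ i ∈ A, a i • y i‖ ≤ C * ‖∑ i ∈ A, a i • e i‖) :
    ∃ U : X →L[𝕜] F, ‖U‖ ≤ C ∧ ∀ i, U (e i) = y i := by
  have hd : DenseRange (Finsupp.linearCombination 𝕜 e) := by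
    rw [← Finsupp.range_linearCombination] at he
    exact he
  have hb : ∀ a, ‖Finsupp.linearCombination 𝕜 y a‖ ≤ C * ‖Finsupp.linearCombination 𝕜 e a‖ :=
    fun a => h a.support a
  refine ⟨(Finsupp.linearCombination 𝕜 y).extendOfNorm (Finsupp.linearCombination 𝕜 e),
    LinearMap.opNorm_extendOfNorm_le hd hC hb, fun i => ?_⟩
  have := LinearMap.extendOfNorm_eq hd ⟨C, hb⟩ (Finsupp.single i 1)
  simpa using this

/-! ### Uniformly bounded rotations of pairs of basis vectors -/

section

variable {𝕜 : Type u} {X : Type v} [RCLike 𝕜] [NormedAddCommGroup X] [NormedSpace 𝕜 X]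

/-- The bounded operator `U` rotates each pair `(u k, v k)` by the angle `θ k`. -/
structure RotatesBy (u v : ℕ → X) (θ : ℕ → ℝ) (U : X →L[𝕜] X) : Prop where
  map_left : ∀ k, U (u k) = (Real.cos (θ k) : 𝕜) • u k + (Real.sin (θ k) : 𝕜) • v k
  map_right : ∀ k, U (v k) = -(Real.sin (θ k) : 𝕜) • u k + (Real.cos (θ k) : 𝕜) • v k

/-- A bounded biorthogonal system consisting of pairs `(u k, v k)` with dense span, on which all
pairwise rotations act uniformly boundedly. -/
structure RotationSystem (u v : ℕ → X) (f g : ℕ → X →L[𝕜] 𝕜) (M : ℝ) : Prop where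
  norm_left_le : ∀ k, ‖u k‖ ≤ M
  norm_right_le : ∀ k, ‖v k‖ ≤ M
  norm_coord_left_le : ∀ k, ‖f k‖ ≤ M
  norm_coord_right_le : ∀ k, ‖g k‖ ≤ M
  left_left : ∀ j k, f j (u k) = if j = k then 1 else 0
  left_right : ∀ j k, f j (v k) = 0
  right_left : ∀ j k, g j (u k) = 0
  right_right : ∀ j k, g j (v k) = if j = k then 1 else 0
  dense_span : Dense (Submodule.span 𝕜 (Set.range u ∪ Set.range v) : Set X)
  exists_rotation : ∀ θ : ℕ → ℝ, ∃ U : X →L[𝕜] X, ‖U‖ ≤ M ∧ RotatesBy u v θ U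

/-- The involution of `ℕ` exchanging `2 * k` and `2 * k + 1`. -/
def pairSwap : Equiv.Perm ℕ :=
  Function.Involutive.toPerm (fun i => if i % 2 = 0 then i + 1 else i - 1) fun i => by
    dsimp only
    split_ifs <;> omega

theorem pairSwap_even (k : ℕ) : pairSwap (2 * k) = 2 * k + 1 := by
  simp [pairSwap, Function.Involutive.toPerm]

theorem pairSwap_odd (k : ℕ) : pairSwap (2 * k + 1) = 2 * k := by
  simp [pairSwap, Function.Involutive.toPerm, Nat.add_mod]

theorem pairSwap_div_two (i : ℕ) : pairSwap i / 2 = i / 2 := by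
  rcases Nat.even_or_odd' i with ⟨k, rfl | rfl⟩
  · rw [pairSwap_even]; omega
  · rw [pairSwap_odd]; omega

theorem range_even_union_range_odd {α : Type*} (E : ℕ → α) :
    Set.range E = Set.range (fun k => E (2 * k)) ∪ Set.range fun k => E (2 * k + 1) := by
  ext x
  simp only [Set.mem_range, Set.mem_union]
  constructor
  · rintro ⟨i, rfl⟩
    rcases Nat.even_or_odd' i with ⟨k, rfl | rfl⟩
    · exact Or.inl ⟨k, rfl⟩
    · exact Or.inr ⟨k, rfl⟩
  · rintro (⟨k, rfl⟩ | ⟨k, rfl⟩)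
    · exact ⟨_, rfl⟩
    · exact ⟨_, rfl⟩

/-- Rescaling the members of each pair of a symmetric system by the norm of the first one. -/
theorem IsSymmetricSystem.exists_pairwise_rescaling {e : ℕ → X} (he : IsSymmetricSystem 𝕜 e) :
    ∃ (E : ℕ → X) (C : ℝ), 1 ≤ C ∧ (∀ k, ‖E (2 * k)‖ = 1) ∧
      Dense (Submodule.span 𝕜 (Set.range E) : Set X) ∧
      (∀ (A : Finset ℕ) (a : ℕ → 𝕜) (t : ℕ → ℝ), (∀ i, |t i| ≤ 1) →
        ‖∑ i ∈ A, (t i : 𝕜) • a i • E i‖ ≤ C * ‖∑ i ∈ A, a i • E i‖) ∧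
      ∀ (A : Finset ℕ) (a : ℕ → 𝕜),
        ‖∑ i ∈ A, a i • E (pairSwap i)‖ ≤ C * ‖∑ i ∈ A, a i • E i‖ := by
  obtain ⟨C₁, hC₁⟩ := he.multiplier
  obtain ⟨C₂, hC₂⟩ := he.perm pairSwap
  -- Both members of a pair receive the same factor, so the rescaling commutes with `pairSwap`.
  let r : ℕ → 𝕜 := fun i => ((‖e (2 * (i / 2))‖⁻¹ : ℝ) : 𝕜)
  have hr0 : ∀ i, r i ≠ 0 := fun i => by
    simp only [r, ne_eq, RCLike.ofReal_eq_zero, inv_eq_zero, norm_eq_zero]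
    exact he.ne_zero _
  have hrs : ∀ i, r (pairSwap i) = r i := fun i => by simp only [r, pairSwap_div_two]
  refine ⟨fun i => r i • e i, max 1 (max C₁ C₂), le_max_left _ _, fun k => ?_, ?_, ?_, ?_⟩
  · have : ‖e (2 * k)‖ ≠ 0 := norm_ne_zero_iff.2 (he.ne_zero _)
    rw [norm_smul]
    simp [r, this]
  · refine he.dense_span.mono ?_
    refine Submodule.span_le.2 ?_
    rintro _ ⟨i, rfl⟩
    have h := Submodule.smul_mem (Submodule.span 𝕜 (Set.range fun i => r i • e i)) (r i)⁻¹
      (Submodule.subset_span ⟨i, rfl⟩)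
    simpa [smul_smul, hr0 i] using h
  · intro A a t ht
    have h := hC₁ A (fun i => a i * r i) t ht
    simp only [smul_smul] at h ⊢
    refine h.trans (mul_le_mul_of_nonneg_right ?_ (norm_nonneg _))
    exact (le_max_left _ _).trans (le_max_right _ _)
  · intro A a
    have h := hC₂ A (fun i => a i * r i)
    simp only [hrs, smul_smul] at h ⊢
    refine h.trans (mul_le_mul_of_nonneg_right ?_ (norm_nonneg _))
    exact (le_max_right _ _).trans (le_max_right _ _)

/-- A simultaneous rotation is a cosine multiplier plus a signed sine multiplier followed by the
swap, hence bounded by `C + C * C` for all angles. The swap also keeps both members of each rescaled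
pair bounded above and below, which bounds the coordinate functionals. -/
theorem IsSymmetricSystem.exists_rotationSystem [CompleteSpace X] {e : ℕ → X}
    (he : IsSymmetricSystem 𝕜 e) :
    ∃ (u v : ℕ → X) (f g : ℕ → X →L[𝕜] 𝕜) (M : ℝ), RotationSystem u v f g M := by
  classical
  obtain ⟨E, C, hC1, hnorm, hdense, hmul, hswap⟩ := he.exists_pairwise_rescaling
  have hC0 : 0 ≤ C := zero_le_one.trans hC1
  have hswap1 : ∀ i, ‖E (pairSwap i)‖ ≤ C * ‖E i‖ := fun i => by
    simpa using hswap {i} (fun _ => 1)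
  have hup : ∀ i, ‖E i‖ ≤ C := by
    intro i
    rcases Nat.even_or_odd' i with ⟨k, rfl | rfl⟩
    · rw [hnorm]; exact hC1
    · have := hswap1 (2 * k)
      rwa [pairSwap_even, hnorm, mul_one] at this
  have hlow : ∀ i, 1 ≤ C * ‖E i‖ := by
    intro i
    rcases Nat.even_or_odd' i with ⟨k, rfl | rfl⟩
    · rw [hnorm, mul_one]; exact hC1
    · have := hswap1 (2 * k + 1)
      rwa [pairSwap_odd, hnorm] at this
  have hcoord : ∀ j, ∃ f : X →L[𝕜] 𝕜, ‖f‖ ≤ C * C ∧ ∀ i, f (E i) = if j = i then 1 else 0 := by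
    intro j
    refine exists_clm_of_norm_sum_le hdense _ (C * C) (by positivity) fun A a => ?_
    have h := hmul A a (fun i => if j = i then 1 else 0) fun i => by split_ifs <;> simp
    by_cases hj : j ∈ A
    · have h' : ‖a j‖ * ‖E j‖ ≤ C * ‖∑ i ∈ A, a i • E i‖ := by
        rw [← norm_smul]
        simpa [ite_smul, hj, apply_ite] using h
      calc ‖∑ i ∈ A, a i • (if j = i then (1 : 𝕜) else 0)‖ = ‖a j‖ := by simp [hj]
        _ ≤ ‖a j‖ * (C * ‖E j‖) := le_mul_of_one_le_right (norm_nonneg _) (hlow j)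
        _ = C * (‖a j‖ * ‖E j‖) := by ring
        _ ≤ C * (C * ‖∑ i ∈ A, a i • E i‖) := by gcongr
        _ = _ := by ring
    · simp only [smul_eq_mul, mul_ite, mul_one, mul_zero, Finset.sum_ite_eq, hj, if_false, norm_zero]
      positivity
  choose F hF hFE using hcoord
  have hCC : C * C ≤ C + C * C := by linarith
  have hCC' : C ≤ C + C * C := by nlinarith
  refine ⟨fun k => E (2 * k), fun k => E (2 * k + 1), fun k => F (2 * k), fun k => F (2 * k + 1),
    C + C * C, fun k => (hup _).trans hCC', fun k => (hup _).trans hCC', fun k => (hF _).trans hCC,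
    fun k => (hF _).trans hCC, ?_, ?_, ?_, ?_, ?_, ?_⟩
  · intro j k
    rw [hFE]
    exact if_congr (by omega) rfl rfl
  · intro j k
    rw [hFE, if_neg (by omega)]
  · intro j k
    rw [hFE, if_neg (by omega)]
  · intro j k
    rw [hFE]
    exact if_congr (by omega) rfl rfl
  · rwa [← range_even_union_range_odd]
  · intro θ
    let c : ℕ → ℝ := fun i => Real.cos (θ (i / 2))
    let s : ℕ → ℝ := fun i => (if i % 2 = 0 then 1 else -1) * Real.sin (θ (i / 2))
    have hc : ∀ i, |c i| ≤ 1 := fun i => Real.abs_cos_le_one _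
    have hs : ∀ i, |s i| ≤ 1 := fun i => by
      simp only [s]
      rw [abs_mul]
      refine mul_le_one₀ ?_ (abs_nonneg _) (Real.abs_sin_le_one _)
      split_ifs <;> simp
    obtain ⟨U, hU, hUE⟩ := exists_clm_of_norm_sum_le hdense
      (fun i => (c i : 𝕜) • E i + (s i : 𝕜) • E (pairSwap i)) (C + C * C) (by positivity) <| by
        intro A a
        have h1 := hmul A a c hc
        have h2 := (hswap A fun i => (s i : 𝕜) * a i)
        have h3 := hmul A a s hs
        have e : ∑ i ∈ A, a i • ((c i : 𝕜) • E i + (s i : 𝕜) • E (pairSwap i)) =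
            ∑ i ∈ A, (c i : 𝕜) • a i • E i + ∑ i ∈ A, ((s i : 𝕜) * a i) • E (pairSwap i) := by
          rw [← Finset.sum_add_distrib]
          refine Finset.sum_congr rfl fun i _ => ?_
          rw [smul_add, smul_smul, smul_smul, smul_smul, mul_comm (a i), mul_comm (a i)]
        simp only [mul_smul] at h2 e
        rw [e]
        refine (norm_add_le _ _).trans ?_
        calc _ ≤ C * ‖∑ i ∈ A, a i • E i‖ + C * (C * ‖∑ i ∈ A, a i • E i‖) :=
              add_le_add h1 (h2.trans (by gcongr))
          _ = _ := by ring
    refine ⟨U, hU, fun k => ?_, fun k => ?_⟩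
    · rw [hUE, pairSwap_even]
      simp [c, s]
    · rw [hUE, pairSwap_odd, add_comm]
      have h1 : (2 * k + 1) / 2 = k := by omega
      have h2 : (2 * k + 1) % 2 = 1 := by omega
      simp [c, s, h1, h2]

end

/-! ### Powers of the perturbed rotation and its construction -/

section

variable {𝕜 : Type u} {X : Type v} [RCLike 𝕜] [NormedAddCommGroup X] [NormedSpace 𝕜 X]

theorem add_pow_apply_of_mul_eq (U K : X →L[𝕜] X) (hKU : K * U = K) (hKK : K * K = 0) (n : ℕ)
    (x : X) : ((U + K) ^ n) x = (U ^ n) x + (∑ i ∈ Finset.range n, U ^ i) (K x) := by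
  have key : ∀ n : ℕ, (U + K) ^ n = U ^ n + (∑ i ∈ Finset.range n, U ^ i) * K := by
    intro n
    induction n with
    | zero => simp
    | succ n ih =>
      rw [pow_succ, ih, Finset.sum_range_succ, pow_succ, add_mul, mul_assoc, mul_add, mul_add K,
        hKU, hKK, add_zero, add_mul]
      abel
  rw [key]
  simp

/-- Convergence on a set with dense span extends to the whole space for a bounded sequence of
operators. -/
theorem tendsto_apply_of_dense_span (T : ℕ → X →L[𝕜] X) (M : ℝ) (hT : ∀ n, ‖T n‖ ≤ M) {s : Set X}
    (hs : Dense (Submodule.span 𝕜 s : Set X))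
    (h : ∀ x ∈ s, Tendsto (fun n => T n x) atTop (𝓝 x)) (x : X) :
    Tendsto (fun n => T n x) atTop (𝓝 x) := by
  have hspan : ∀ y ∈ Submodule.span 𝕜 s, Tendsto (fun n => T n y) atTop (𝓝 y) := by
    intro y hy
    induction hy using Submodule.span_induction with
    | mem y hy => exact h y hy
    | zero => simp
    | add y z _ _ hy hz => simpa using hy.add hz
    | smul a y _ hy => simpa using hy.const_smul a
  have hM : 0 ≤ M := (norm_nonneg _).trans (hT 0)
  rw [Metric.tendsto_atTop]
  intro ε hε
  obtain ⟨y, hy, hxy⟩ := Metric.dense_iff.1 hs x (ε / (2 * (M + 1))) (by positivity)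
  rw [Metric.mem_ball, dist_comm, dist_eq_norm, lt_div_iff₀ (by positivity)] at hy
  obtain ⟨N, hN⟩ := Metric.tendsto_atTop.1 (hspan _ hxy) (ε / 2) (by positivity)
  refine ⟨N, fun n hn => ?_⟩
  have h1 := hN n hn
  rw [dist_eq_norm] at h1 ⊢
  have e : T n x - x = T n (x - y) + (T n y - y) - (x - y) := by rw [map_sub]; abel
  rw [e]
  have h2 := (T n).le_of_opNorm_le (hT n) (x - y)
  calc _ ≤ ‖T n (x - y)‖ + ‖T n y - y‖ + ‖x - y‖ :=
        (norm_sub_le _ _).trans (by gcongr; exact norm_add_le _ _)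
    _ < ε := by linarith

namespace RotatesBy

variable {u v : ℕ → X} {θ φ : ℕ → ℝ} {U V : X →L[𝕜] X}

theorem mul (hU : RotatesBy u v θ U) (hV : RotatesBy u v φ V) :
    RotatesBy u v (fun k => θ k + φ k) (U * V) where
  map_left k := by
    simp only [mul_apply_eq_comp, hV.map_left, hU.map_left, hU.map_right, map_add,
      map_smul, Real.cos_add, Real.sin_add, RCLike.ofReal_sub,
      RCLike.ofReal_mul]
    module
  map_right k := by
    simp only [mul_apply_eq_comp, hV.map_right, hU.map_left, hU.map_right, map_add,
      map_smul, Real.cos_add, Real.sin_add, RCLike.ofReal_sub,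
      RCLike.ofReal_mul]
    module

theorem pow (hU : RotatesBy u v θ U) (n : ℕ) : RotatesBy u v (fun k => n * θ k) (U ^ n) := by
  induction n with
  | zero => constructor <;> simp
  | succ n ih =>
    have := ih.mul hU
    rw [pow_succ]
    convert this using 2
    push_cast
    ring

theorem eq (hU : RotatesBy u v θ U) (hV : RotatesBy u v θ V)
    (h : Dense (Submodule.span 𝕜 (Set.range u ∪ Set.range v) : Set X)) : U = V := by
  refine ContinuousLinearMap.ext_on h ?_
  rintro _ (⟨k, rfl⟩ | ⟨k, rfl⟩)
  · rw [hU.map_left, hV.map_left]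
  · rw [hU.map_right, hV.map_right]

theorem fixed (hU : RotatesBy u v θ U) {k l : ℕ} (h : θ k = l * (2 * Real.pi)) :
    U (u k) = u k ∧ U (v k) = v k := by
  have hc : Real.cos (θ k) = 1 := by rw [h]; exact Real.cos_nat_mul_two_pi l
  have hs : Real.sin (θ k) = 0 := by
    rw [h, show (l : ℝ) * (2 * Real.pi) = (2 * l : ℕ) * Real.pi by push_cast; ring]
    exact Real.sin_nat_mul_pi _
  rw [hU.map_left, hU.map_right, hc, hs]
  simp

end RotatesBy

namespace RotationSystem

variable {u v : ℕ → X} {f g : ℕ → X →L[𝕜] 𝕜} {M : ℝ}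

/-- Every power is again a rotation, with angles `n * θ k`, so the uniform bound on all rotations
gives power boundedness. -/
theorem norm_pow_le (h : RotationSystem u v f g M) {θ : ℕ → ℝ} {U : X →L[𝕜] X}
    (hU : RotatesBy u v θ U) (n : ℕ) : ‖U ^ n‖ ≤ M := by
  obtain ⟨V, hV, hV'⟩ := h.exists_rotation fun k => n * θ k
  rwa [(hU.pow n).eq hV' h.dense_span]

theorem coord_zero_comp (h : RotationSystem u v f g M) {θ : ℕ → ℝ} {U : X →L[𝕜] X}
    (hU : RotatesBy u v θ U) (h0 : θ 0 = 2 * Real.pi) (x : X) :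
    f 0 (U x) = f 0 x ∧ g 0 (U x) = g 0 x := by
  obtain ⟨hu, hv⟩ := hU.fixed (k := 0) (l := 1) (by simp [h0])
  have h1 : (f 0).comp U = f 0 := by
    refine ContinuousLinearMap.ext_on h.dense_span ?_
    rintro _ (⟨k, rfl⟩ | ⟨k, rfl⟩)
    · rcases Nat.eq_zero_or_pos k with rfl | hk
      · simp [hu]
      · simp [hU.map_left, h.left_left, h.left_right, hk.ne]
    · rcases Nat.eq_zero_or_pos k with rfl | hk
      · simp [hv]
      · simp [hU.map_right, h.left_left, h.left_right, hk.ne]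
  have h2 : (g 0).comp U = g 0 := by
    refine ContinuousLinearMap.ext_on h.dense_span ?_
    rintro _ (⟨k, rfl⟩ | ⟨k, rfl⟩)
    · rcases Nat.eq_zero_or_pos k with rfl | hk
      · simp [hu]
      · simp [hU.map_left, h.right_left, h.right_right, hk.ne]
    · rcases Nat.eq_zero_or_pos k with rfl | hk
      · simp [hv]
      · simp [hU.map_right, h.right_left, h.right_right, hk.ne]
  exact ⟨DFunLike.congr_fun h1 x, DFunLike.congr_fun h2 x⟩

end RotationSystem

theorem RotatesBy.sum_pow_apply {u v : ℕ → X} {m : ℕ → ℕ} {U : X →L[𝕜] X}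
    (hU : RotatesBy u v (fun k => 2 * (Real.pi / m k)) U) (n k : ℕ) :
    (∑ i ∈ Finset.range n, U ^ i) (u k) =
      (cosSum (m k) n : 𝕜) • u k + (sinSum (m k) n : 𝕜) • v k := by
  simp only [sum_apply, (hU.pow _).map_left, Finset.sum_add_distrib,
    ← Finset.sum_smul, cosSum, sinSum, RCLike.ofReal_sum]

/-- The data of the construction: a rotation `U` with angles `2π / m k`, and a perturbation `K`
which feeds the first pair of coordinates into the vectors `u (k + 1)`. -/
structure Machine (u v : ℕ → X) (f g : ℕ → X →L[𝕜] 𝕜) (M : ℝ) (c : ℕ → 𝕜) (w m : ℕ → ℕ)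
    (U K : X →L[𝕜] X) : Prop where
  system : RotationSystem u v f g M
  zero : m 0 = 1
  dvd : ∀ k, m k ∣ m (k + 1)
  growth : ∀ k, 4 * m k ≤ m (k + 1)
  small : ∀ k, (w (k + 1) : ℝ) * (1 + ‖c (k + 1)‖) * m k ≤ (1 / 4) ^ (k + 1) * m (k + 1)
  rotates : RotatesBy u v (fun k => 2 * (Real.pi / m k)) U
  hasSum : ∀ x, HasSum (fun k => (((w k / m k : ℝ) : 𝕜) * (f 0 x - c k * g 0 x)) • u (k + 1)) (K x)

theorem RotationSystem.exists_machine [CompleteSpace X] {u v : ℕ → X} {f g : ℕ → X →L[𝕜] 𝕜} {M : ℝ}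
    (h : RotationSystem u v f g M) (c : ℕ → 𝕜) (w : ℕ → ℕ) :
    ∃ (m : ℕ → ℕ) (U K : X →L[𝕜] X), Machine u v f g M c w m U K := by
  -- The coefficient of `u (k + 2)` in `K x` has weight `w (k + 1) / m (k + 1)`. Making it small
  -- even after multiplication by `m k` gives convergence of `K` and controls that term at all times
  -- up to `m k`.
  obtain ⟨m, m0, hdvd, hgrow, hB⟩ :=
    exists_dvd_chain fun k => 4 ^ (k + 1) * ((w (k + 1) : ℝ) * (1 + ‖c (k + 1)‖))
  have hM : 0 ≤ M := (norm_nonneg _).trans (h.norm_left_le 0)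
  have hpos : ∀ k, 1 ≤ m k := by
    intro k
    induction k with
    | zero => exact m0.ge
    | succ k ih => linarith [hgrow k]
  have hsmall : ∀ k, (w (k + 1) : ℝ) * (1 + ‖c (k + 1)‖) * m k ≤ (1 / 4) ^ (k + 1) * m (k + 1) := by
    intro k
    have h4 : (1 / 4 : ℝ) ^ (k + 1) * 4 ^ (k + 1) = 1 := by rw [← mul_pow]; norm_num
    calc (w (k + 1) : ℝ) * (1 + ‖c (k + 1)‖) * m k
        = (1 / 4) ^ (k + 1) * 4 ^ (k + 1) * ((w (k + 1) : ℝ) * (1 + ‖c (k + 1)‖) * m k) := by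
          rw [h4, one_mul]
      _ = (1 / 4) ^ (k + 1) * (4 ^ (k + 1) * ((w (k + 1) : ℝ) * (1 + ‖c (k + 1)‖)) * m k) := by ring
      _ ≤ _ := mul_le_mul_of_nonneg_left (hB k) (by positivity)
  obtain ⟨U, -, hU⟩ := h.exists_rotation fun k => 2 * (Real.pi / m k)
  let T : ℕ → X →L[𝕜] X := fun k =>
    (((w k / m k : ℝ) : 𝕜) • (f 0 - c k • g 0)).smulRight (u (k + 1))
  have hT : ∀ k, ‖T k‖ ≤ (w k : ℝ) / m k * (1 + ‖c k‖) * (M * M) := by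
    intro k
    refine (ContinuousLinearMap.norm_smulRight_apply _ _).trans_le ?_
    rw [norm_smul, RCLike.norm_ofReal, abs_of_nonneg (by positivity)]
    have h1 : ‖f 0 - c k • g 0‖ ≤ (1 + ‖c k‖) * M := by
      refine (norm_sub_le _ _).trans ?_
      rw [norm_smul, add_mul, one_mul]
      gcongr
      · exact h.norm_coord_left_le 0
      · exact h.norm_coord_right_le 0
    calc _ ≤ (w k : ℝ) / m k * ((1 + ‖c k‖) * M) * M := by
          gcongr
          exact h.norm_left_le _
      _ = _ := by ring
  have hsum : Summable T := by
    refine Summable.of_norm ?_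
    rw [← summable_nat_add_iff 1]
    refine Summable.of_nonneg_of_le (fun _ => norm_nonneg _) (fun k => ?_)
      (((summable_nat_add_iff 1).2 (summable_geometric_of_lt_one (r := 1 / 4) (by norm_num)
        (by norm_num))).mul_right (M * M))
    refine (hT _).trans (mul_le_mul_of_nonneg_right ?_ (by positivity))
    have hm1 : (0 : ℝ) < m (k + 1) := by exact_mod_cast hpos _
    rw [div_mul_eq_mul_div, div_le_iff₀ hm1]
    refine le_trans ?_ (hsmall k)
    refine le_mul_of_one_le_right (by positivity) ?_
    exact_mod_cast hpos k
  refine ⟨m, U, ∑' k, T k, h, m0, hdvd, hgrow, hsmall, hU, fun x => ?_⟩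
  have := hsum.hasSum.mapL (ContinuousLinearMap.apply 𝕜 X x)
  simpa [T] using! this

end

/-! ### Orbits: escape on a hyperplane, recurrence elsewhere -/

section

variable {𝕜 : Type u} {X : Type v} [RCLike 𝕜] [NormedAddCommGroup X] [NormedSpace 𝕜 X]

namespace Machine

variable {u v : ℕ → X} {f g : ℕ → X →L[𝕜] 𝕜} {M : ℝ} {c : ℕ → 𝕜} {w m : ℕ → ℕ} {U K : X →L[𝕜] X}

theorem one_le (h : Machine u v f g M c w m U K) (k : ℕ) : 1 ≤ m k := by
  induction k with
  | zero => exact h.zero.ge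
  | succ k ih => linarith [h.growth k]

theorem strictMono (h : Machine u v f g M c w m U K) : StrictMono m :=
  strictMono_nat_of_lt_succ fun k => by linarith [h.growth k, h.one_le k]

theorem dvd_of_le (h : Machine u v f g M c w m U K) {j k : ℕ} (hjk : j ≤ k) : m j ∣ m k :=
  Nat.le_induction dvd_rfl (fun _ _ ih => ih.trans (h.dvd _)) k hjk

theorem two_le (h : Machine u v f g M c w m U K) (k : ℕ) : 2 ≤ m (k + 1) := by
  linarith [h.growth k, h.one_le k]

theorem coord_zero_rotation (h : Machine u v f g M c w m U K) (x : X) :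
    f 0 (U x) = f 0 x ∧ g 0 (U x) = g 0 x :=
  h.system.coord_zero_comp h.rotates (by simp [h.zero]) x

theorem hasSum_pow (h : Machine u v f g M c w m U K) (n : ℕ) (x : X) :
    HasSum (fun k => (((w k / m k : ℝ) : 𝕜) * (f 0 x - c k * g 0 x)) •
      ((cosSum (m (k + 1)) n : 𝕜) • u (k + 1) + (sinSum (m (k + 1)) n : 𝕜) • v (k + 1)))
      (((U + K) ^ n) x - (U ^ n) x) := by
  have hKU : K * U = K := by
    ext x
    have h1 := h.hasSum (U x)
    rw [(h.coord_zero_rotation x).1, (h.coord_zero_rotation x).2] at h1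
    exact h1.unique (h.hasSum x)
  have hKK : K * K = 0 := by
    ext x
    have hf : f 0 (K x) = 0 := by
      have h1 := (h.hasSum x).mapL (f 0)
      simp only [map_smul, h.system.left_left, (Nat.succ_ne_zero _).symm, if_false,
        smul_zero] at h1
      exact h1.unique hasSum_zero
    have hg : g 0 (K x) = 0 := by
      have h1 := (h.hasSum x).mapL (g 0)
      simp only [map_smul, h.system.right_left, smul_zero] at h1
      exact h1.unique hasSum_zero
    have h1 := h.hasSum (K x)
    simp only [hf, hg, mul_zero, sub_zero, zero_smul] at h1
    exact h1.unique hasSum_zero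
  rw [add_pow_apply_of_mul_eq U K hKU hKK, add_sub_cancel_left]
  have h1 := (h.hasSum x).mapL (∑ i ∈ Finset.range n, U ^ i)
  simpa only [map_smul, h.rotates.sum_pow_apply] using h1

theorem coord_pow (h : Machine u v f g M c w m U K) (n j : ℕ) (x : X) :
    f (j + 1) (((U + K) ^ n) x - (U ^ n) x) =
      ((w j / m j : ℝ) : 𝕜) * (f 0 x - c j * g 0 x) * (cosSum (m (j + 1)) n : 𝕜) ∧
    g (j + 1) (((U + K) ^ n) x - (U ^ n) x) =
      ((w j / m j : ℝ) : 𝕜) * (f 0 x - c j * g 0 x) * (sinSum (m (j + 1)) n : 𝕜) := by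
  constructor
  · have h1 := (h.hasSum_pow n x).mapL (f (j + 1))
    refine (h1.unique (hasSum_single j fun k hk => ?_)).trans ?_
    · simp [h.system.left_left, h.system.left_right, hk.symm]
    · simp [h.system.left_left, h.system.left_right]
  · have h1 := (h.hasSum_pow n x).mapL (g (j + 1))
    refine (h1.unique (hasSum_single j fun k hk => ?_)).trans ?_
    · simp [h.system.right_left, h.system.right_right, hk.symm]
    · simp [h.system.right_left, h.system.right_right]

/-- At every time at least `m k`, some pair of coordinates has moved far. -/
theorem exists_lt_mul (h : Machine u v f g M c w m U K) {k n : ℕ} (h1 : m k ≤ n)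
    (h2 : n < m (k + 1)) :
    ∃ j, k ≤ j ∧ (1 / 2 : ℝ) ≤ 2 * (|cosSum (m (j + 1)) n| + |sinSum (m (j + 1)) n|) / m j := by
  -- The geometric sum on pair `k + 1` returns to zero at `n = m (k + 1)`. Close to that time pair
  -- `k + 2` takes over: its period is at least `4 * m (k + 1)`, and `n` is already more than half
  -- of `m (k + 1)`.
  by_cases hn : n + m k ≤ m (k + 1)
  · refine ⟨k, le_rfl, ?_⟩
    have hk : (0 : ℝ) < m k := by exact_mod_cast h.one_le k
    rw [le_div_iff₀ hk]
    have := le_cosSum_add_sinSum (h.two_le k) h1 hn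
    linarith
  · refine ⟨k + 1, Nat.le_succ _, ?_⟩
    have hk : (0 : ℝ) < m (k + 1) := by exact_mod_cast h.one_le _
    rw [le_div_iff₀ hk]
    have g1 := h.growth k
    have g2 := h.growth (k + 1)
    have := le_cosSum_add_sinSum (h.two_le (k + 1)) (le_refl n) (by omega)
    refine le_trans ?_ this
    have : m (k + 1) ≤ 2 * n := by omega
    have : (m (k + 1) : ℝ) ≤ 2 * n := by exact_mod_cast this
    linarith

theorem mem_escapingSet (h : Machine u v f g M c w m U K) (hw : Tendsto w atTop atTop) {x : X}
    (hg : g 0 x = 0) (hf : f 0 x ≠ 0) : x ∈ escapingSet (U + K) := by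
  have hM : 0 ≤ M := (norm_nonneg _).trans (h.system.norm_left_le 0)
  have hf0 : 0 < ‖f 0 x‖ := norm_pos_iff.2 hf
  refine tendsto_atTop.2 fun b => ?_
  obtain ⟨k₀, hk₀⟩ := eventually_atTop.1
    ((tendsto_natCast_atTop_atTop.comp hw).eventually_ge_atTop
      -- Chosen to match `hmain` below, where `w j * ‖f 0 x‖ / 2` is bounded by `4 * (M * (‖y‖ + M *
      -- ‖x‖))`.
      (2 * (4 * (M * (|b| + M * ‖x‖))) / ‖f 0 x‖))
  filter_upwards [eventually_ge_atTop (m k₀), eventually_ge_atTop 1] with n hn hn1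
  obtain ⟨k, hk, hk1, hk2⟩ : ∃ k, k₀ ≤ k ∧ m k ≤ n ∧ n < m (k + 1) := by
    have hex : ∃ k, n < m (k + 1) := ⟨n, (Nat.lt_succ_self n).trans_le (h.strictMono.le_apply)⟩
    classical
    have hspec := Nat.find_spec hex
    refine ⟨Nat.find hex, ?_, ?_, hspec⟩
    · by_contra hlt
      exact absurd (h.strictMono.monotone (show Nat.find hex + 1 ≤ k₀ by omega)) (by omega)
    · rcases Nat.eq_zero_or_pos (Nat.find hex) with h0 | h0
      · rw [h0, h.zero]; exact hn1
      · have := Nat.find_min hex (m := Nat.find hex - 1) (by omega)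
        rw [Nat.sub_add_cancel h0] at this
        omega
  obtain ⟨j, hj, hbig⟩ := h.exists_lt_mul hk1 hk2
  obtain ⟨hc, hs⟩ := h.coord_pow n j x
  set y := ((U + K) ^ n) x with hy
  have hwj := hk₀ j (hk.trans hj)
  rw [Function.comp_apply, div_le_iff₀ hf0] at hwj
  rw [hg, mul_zero, sub_zero] at hc hs
  have hmj : (0 : ℝ) ≤ w j / m j := by positivity
  have nc := congrArg norm hc
  have ns := congrArg norm hs
  rw [norm_mul, norm_mul, RCLike.norm_ofReal, RCLike.norm_ofReal, abs_of_nonneg hmj] at nc ns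
  have bd : ‖y - (U ^ n) x‖ ≤ ‖y‖ + M * ‖x‖ := (norm_sub_le _ _).trans
    (by gcongr; exact (U ^ n).le_of_opNorm_le (h.system.norm_pow_le h.rotates n) x)
  have bc := (f (j + 1)).le_of_opNorm_le (h.system.norm_coord_left_le _) (y - (U ^ n) x)
  have bs := (g (j + 1)).le_of_opNorm_le (h.system.norm_coord_right_le _) (y - (U ^ n) x)
  have hB : M * ‖y - (U ^ n) x‖ ≤ M * (‖y‖ + M * ‖x‖) := mul_le_mul_of_nonneg_left bd hM
  have hmain : (w j : ℝ) * ‖f 0 x‖ * (1 / 2) ≤ 4 * (M * (‖y‖ + M * ‖x‖)) := by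
    calc (w j : ℝ) * ‖f 0 x‖ * (1 / 2)
        ≤ w j * ‖f 0 x‖ * (2 * (|cosSum (m (j + 1)) n| + |sinSum (m (j + 1)) n|) / m j) := by
          gcongr
      _ = 2 * ((w j / m j : ℝ) * ‖f 0 x‖ * |cosSum (m (j + 1)) n| +
          (w j / m j : ℝ) * ‖f 0 x‖ * |sinSum (m (j + 1)) n|) := by ring
      _ ≤ 4 * (M * (‖y‖ + M * ‖x‖)) := by linarith
  have hfin : M * (|b| + M * ‖x‖) ≤ M * (‖y‖ + M * ‖x‖) := by linarith
  have hMpos : 0 < M := by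
    refine hM.lt_of_ne fun h0 => ?_
    have := h.system.norm_coord_left_le 0
    rw [← h0, norm_le_zero_iff] at this
    exact hf (by simp [this])
  have := le_of_mul_le_mul_left hfin hMpos
  linarith [le_abs_self b]

theorem norm_pow_sub_le (h : Machine u v f g M c w m U K) (k : ℕ) (x : X) :
    ‖((U + K) ^ m k) x - (U ^ m k) x‖ ≤
      w k * ‖f 0 x - c k * g 0 x‖ * (2 * M) + 4 * M ^ 2 * ‖x‖ * (1 / 2) ^ k := by
  have hM : 0 ≤ M := (norm_nonneg _).trans (h.system.norm_left_le 0)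
  have hpos : ∀ j, (0 : ℝ) < m j := fun j => by exact_mod_cast h.one_le j
  -- Majorant of the series: the resonant term `j = k`, where the factor `m k` cancels, plus a
  -- geometric tail for `j > k`. Terms with `j < k` vanish because `m (j + 1)` divides `m k`.
  have hsum : HasSum (fun j => (if j = k then w k * ‖f 0 x - c k * g 0 x‖ * (2 * M) else 0) +
      2 * M ^ 2 * ‖x‖ * (1 / 2) ^ k * (1 / 2 : ℝ) ^ j)
      (w k * ‖f 0 x - c k * g 0 x‖ * (2 * M) + 2 * M ^ 2 * ‖x‖ * (1 / 2) ^ k * 2) := by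
    refine (hasSum_ite_eq k _).add ?_
    exact hasSum_geometric_two.mul_left _
  have hle := (h.hasSum_pow (m k) x).norm_le_of_bounded hsum fun j => ?_
  · exact hle.trans (le_of_eq (by ring))
  have hvec : ‖(cosSum (m (j + 1)) (m k) : 𝕜) • u (j + 1) +
      (sinSum (m (j + 1)) (m k) : 𝕜) • v (j + 1)‖ ≤ m k * (2 * M) := by
    refine (norm_add_le _ _).trans ?_
    rw [norm_smul, norm_smul, RCLike.norm_ofReal, RCLike.norm_ofReal]
    calc _ ≤ (m k : ℝ) * M + m k * M := by
          gcongr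
          · exact abs_cosSum_le _ _
          · exact h.system.norm_left_le _
          · exact abs_sinSum_le _ _
          · exact h.system.norm_right_le _
      _ = _ := by ring
  have hr : (0 : ℝ) ≤ 2 * M ^ 2 * ‖x‖ * (1 / 2) ^ k * (1 / 2) ^ j := by positivity
  rw [norm_smul, norm_mul, RCLike.norm_ofReal, abs_of_nonneg (by positivity)]
  rcases lt_trichotomy j k with hj | rfl | hj
  · obtain ⟨h1, h2⟩ := cosSum_sinSum_eq_zero (h.two_le j) (h.dvd_of_le (Nat.succ_le_of_lt hj))
    rw [h1, h2, if_neg hj.ne]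
    simpa using hr
  · rw [if_pos rfl]
    refine le_trans ?_ (le_add_of_nonneg_right hr)
    calc _ ≤ (w j : ℝ) / m j * ‖f 0 x - c j * g 0 x‖ * (m j * (2 * M)) := by gcongr
      _ = _ := by
        have := (hpos j).ne'
        field_simp
  · rw [if_neg hj.ne', zero_add]
    obtain ⟨i, rfl⟩ : ∃ i, j = i + 1 := ⟨j - 1, by omega⟩
    have hx : ‖f 0 x - c (i + 1) * g 0 x‖ ≤ (1 + ‖c (i + 1)‖) * (M * ‖x‖) := by
      refine (norm_sub_le _ _).trans ?_
      rw [norm_mul, add_mul, one_mul]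
      gcongr
      · exact (f 0).le_of_opNorm_le (h.system.norm_coord_left_le 0) x
      · exact (g 0).le_of_opNorm_le (h.system.norm_coord_right_le 0) x
    have hmk : (m k : ℝ) ≤ m i := by exact_mod_cast h.strictMono.monotone (Nat.lt_succ_iff.1 hj)
    have hw : (w (i + 1) : ℝ) / m (i + 1) * (1 + ‖c (i + 1)‖) * m k ≤ (1 / 4) ^ (i + 1) := by
      rw [div_mul_eq_mul_div, div_mul_eq_mul_div, div_le_iff₀ (hpos _)]
      exact le_trans (by gcongr) (h.small i)
    have h4 : (1 / 4 : ℝ) ^ (i + 1) ≤ (1 / 2) ^ k * (1 / 2) ^ (i + 1) := by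
      rw [show (1 / 4 : ℝ) = 1 / 2 * (1 / 2) by norm_num, mul_pow]
      refine mul_le_mul_of_nonneg_right ?_ (by positivity)
      exact pow_le_pow_of_le_one (by norm_num) (by norm_num) hj.le
    calc _ ≤ (w (i + 1) : ℝ) / m (i + 1) * ((1 + ‖c (i + 1)‖) * (M * ‖x‖)) * (m k * (2 * M)) := by
          gcongr
      _ = (w (i + 1) : ℝ) / m (i + 1) * (1 + ‖c (i + 1)‖) * m k * (2 * M ^ 2 * ‖x‖) := by ring
      _ ≤ (1 / 2) ^ k * (1 / 2) ^ (i + 1) * (2 * M ^ 2 * ‖x‖) := by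
          exact mul_le_mul_of_nonneg_right (hw.trans h4) (by positivity)
      _ = _ := by ring

theorem tendsto_rotation (h : Machine u v f g M c w m U K) (x : X) :
    Tendsto (fun k => (U ^ m k) x) atTop (𝓝 x) := by
  refine tendsto_apply_of_dense_span (fun k => U ^ m k) M
    (fun k => h.system.norm_pow_le h.rotates _) h.system.dense_span ?_ x
  have key : ∀ j, ∀ k ≥ j, (U ^ m k) (u j) = u j ∧ (U ^ m k) (v j) = v j := by
    intro j k hjk
    obtain ⟨l, hl⟩ := h.dvd_of_le hjk
    refine (h.rotates.pow (m k)).fixed (l := l) ?_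
    have : (m j : ℝ) ≠ 0 := by
      have := h.one_le j
      positivity
    rw [hl]
    push_cast
    field_simp
  rintro _ (⟨j, rfl⟩ | ⟨j, rfl⟩)
  · exact tendsto_const_nhds.congr' ((eventually_ge_atTop j).mono fun k hk => (key j k hk).1.symm)
  · exact tendsto_const_nhds.congr' ((eventually_ge_atTop j).mono fun k hk => (key j k hk).2.symm)

theorem exists_tendsto_subseq (h : Machine u v f g M c w m U K)
    (hc : ∀ z : 𝕜, ∀ ε > 0, ∃ᶠ k in atTop, (w k : ℝ) * ‖z - c k‖ < ε) {x : X}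
    (hx : g 0 x ≠ 0 ∨ f 0 x = 0) :
    ∃ φ : ℕ → ℕ, StrictMono φ ∧ Tendsto (fun k => ((U + K) ^ φ k) x) atTop (𝓝 x) := by
  have hfreq : ∀ ε > 0, ∃ᶠ k in atTop, (w k : ℝ) * ‖f 0 x - c k * g 0 x‖ < ε := by
    intro ε hε
    by_cases hg : g 0 x = 0
    · have hf := hx.resolve_left (not_not.2 hg)
      simp only [hf, hg, mul_zero, sub_zero, norm_zero]
      exact Frequently.of_forall fun _ => hε
    · have hg' : 0 < ‖g 0 x‖ := norm_pos_iff.2 hg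
      refine (hc (f 0 x / g 0 x) (ε / ‖g 0 x‖) (by positivity)).mono fun k hk => ?_
      rw [lt_div_iff₀ hg', mul_assoc, ← norm_mul, sub_mul, div_mul_cancel₀ _ hg] at hk
      exact hk
  -- Being small infinitely often for each `ε` says that `0` is a cluster point, which yields a
  -- single subsequence tending to `0`.
  have hcl : MapClusterPt (0 : ℝ) atTop fun k => (w k : ℝ) * ‖f 0 x - c k * g 0 x‖ := by
    rw [mapClusterPt_iff_frequently]
    intro s hs
    obtain ⟨ε, hε, hs⟩ := Metric.mem_nhds_iff.1 hs
    refine (hfreq ε hε).mono fun k hk => hs ?_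
    rw [mem_ball_zero_iff, Real.norm_of_nonneg (by positivity)]
    exact hk
  obtain ⟨φ, hφ, hlim⟩ := hcl.tendsto_subseq
  refine ⟨fun k => m (φ k), h.strictMono.comp hφ, ?_⟩
  have h1 : Tendsto (fun k => (U ^ m (φ k)) x) atTop (𝓝 x) :=
    (h.tendsto_rotation x).comp hφ.tendsto_atTop
  have h2 : Tendsto (fun k => ((U + K) ^ m (φ k)) x - (U ^ m (φ k)) x) atTop (𝓝 0) := by
    refine squeeze_zero_norm (fun k => h.norm_pow_sub_le (φ k) x) ?_
    have ha := hlim.mul_const (2 * M)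
    have hb := ((tendsto_pow_atTop_nhds_zero_of_lt_one (r := (1 / 2 : ℝ)) (by norm_num)
      (by norm_num)).comp hφ.tendsto_atTop).const_mul (4 * M ^ 2 * ‖x‖)
    simpa using! ha.add hb
  simpa using h2.add h1

end Machine

theorem notMem_escapingSet_of_tendsto_subseq {T : X →L[𝕜] X} {x : X} {φ : ℕ → ℕ}
    (hφ : StrictMono φ) (h : Tendsto (fun k => (T ^ φ k) x) atTop (𝓝 x)) : x ∉ escapingSet T :=
  fun hx => not_tendsto_nhds_of_tendsto_atTop
    (Tendsto.comp (g := fun n : ℕ => ‖(T ^ n) x‖) hx hφ.tendsto_atTop) _ h.norm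

theorem IsSymmetricSystem.admitsMachineOperator [CompleteSpace X] {e : ℕ → X}
    (he : IsSymmetricSystem 𝕜 e) : AdmitsMachineOperator 𝕜 X := by
  obtain ⟨u, v, f, g, M, hsys⟩ := he.exists_rotationSystem
  obtain ⟨c, w, hw, hc⟩ := exists_frequently_mul_norm_sub_lt 𝕜
  obtain ⟨m, U, K, h⟩ := hsys.exists_machine c w
  refine ⟨U + K, ⟨u 0, h.mem_escapingSet hw ?_ ?_⟩, ?_, fun x hx => ?_⟩
  · rw [hsys.right_left]
  · rw [hsys.left_left, if_pos rfl]; exact one_ne_zero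
  · have hsub : escapingSet (U + K) ⊆ (LinearMap.ker (g 0 : X →ₗ[𝕜] 𝕜) : Set X) := by
      intro x hx
      by_contra hg
      obtain ⟨φ, hφ, hlim⟩ := h.exists_tendsto_subseq hc (x := x) (Or.inl hg)
      exact notMem_escapingSet_of_tendsto_subseq hφ hlim hx
    have hclosed : IsClosed (LinearMap.ker (g 0 : X →ₗ[𝕜] 𝕜) : Set X) :=
      (g 0).isClosed_ker
    refine IsNowhereDense.mono hsub ?_
    rw [hclosed.isNowhereDense_iff]
    by_contra hne
    -- A subspace with interior is everything, but `g 0 (v 0) = 1`.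
    have htop := Submodule.eq_top_of_nonempty_interior' _ (Set.nonempty_iff_ne_empty.2 hne)
    have : v 0 ∈ LinearMap.ker (g 0 : X →ₗ[𝕜] 𝕜) := htop ▸ Submodule.mem_top
    have h1 : g 0 (v 0) = 0 := this
    rw [hsys.right_right, if_pos rfl] at h1
    exact one_ne_zero h1
  · have hx' : g 0 x ≠ 0 ∨ f 0 x = 0 := by
      by_contra hcon
      push Not at hcon
      exact hx (h.mem_escapingSet hw hcon.1 hcon.2)
    obtain ⟨φ, hφ, hlim⟩ := h.exists_tendsto_subseq hc hx'
    exact ⟨φ, hφ, ((toWeakSpaceCLM 𝕜 X).continuous.tendsto x).comp hlim⟩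

end

/-! ### Unit vectors of `ℓ_p` and `c₀` -/

/-- A sequence with dense span whose finite linear combinations have norms which depend
monotonically on the absolute values of the coefficients, in any order, is a symmetric system. -/
theorem IsSymmetricSystem.of_norm_sum_le {𝕜 : Type u} {X : Type v} [RCLike 𝕜]
    [NormedAddCommGroup X] [NormedSpace 𝕜 X] {e : ℕ → X} (h0 : ∀ i, e i ≠ 0)
    (hd : Dense (Submodule.span 𝕜 (Set.range e) : Set X))
    (h : ∀ (σ : Equiv.Perm ℕ) (A : Finset ℕ) (a b : ℕ → 𝕜), (∀ i, ‖a i‖ ≤ ‖b i‖) →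
      ‖∑ i ∈ A, a i • e (σ i)‖ ≤ ‖∑ i ∈ A, b i • e i‖) : IsSymmetricSystem 𝕜 e where
  ne_zero := h0
  dense_span := hd
  multiplier := by
    refine ⟨1, fun A a t ht => ?_⟩
    rw [one_mul]
    simp only [smul_smul]
    refine h 1 A _ _ fun i => ?_
    rw [norm_mul, RCLike.norm_ofReal]
    exact mul_le_of_le_one_left (norm_nonneg _) (ht i)
  perm σ := ⟨1, fun A a => by rw [one_mul]; exact h σ A a a fun _ => le_rfl⟩

section lp

variable (𝕜 : Type u) [RCLike 𝕜] (p : ℝ≥0∞) [Fact (1 ≤ p)]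

theorem lp.norm_sum_smul_single_perm (hp : p ≠ ∞) (σ : Equiv.Perm ℕ) (A : Finset ℕ) (a : ℕ → 𝕜) :
    ‖∑ i ∈ A, a i • (lp.single p (σ i) (1 : 𝕜) : lp (fun _ : ℕ => 𝕜) p)‖ ^ p.toReal =
      ∑ i ∈ A, ‖a i‖ ^ p.toReal := by
  have hp' : 0 < p.toReal := ENNReal.toReal_pos (zero_lt_one.trans_le Fact.out).ne' hp
  have h := lp.norm_sum_single (E := fun _ : ℕ => 𝕜) hp' (fun j => a (σ.symm j))
    (A.map σ.toEmbedding)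
  rw [Finset.sum_map, Finset.sum_map] at h
  simp only [Equiv.coe_toEmbedding, Equiv.symm_apply_apply] at h
  rw [← h]
  congr 2
  refine Finset.sum_congr rfl fun i _ => ?_
  rw [← lp.single_smul, smul_eq_mul, mul_one]

theorem lp.isSymmetricSystem (hp : p ≠ ∞) :
    IsSymmetricSystem 𝕜 fun i => (lp.single p i (1 : 𝕜) : lp (fun _ : ℕ => 𝕜) p) := by
  have hp0 : 0 < p := zero_lt_one.trans_le Fact.out
  have hp' : 0 < p.toReal := ENNReal.toReal_pos hp0.ne' hp
  refine IsSymmetricSystem.of_norm_sum_le (fun i hi => ?_) (fun x => ?_) fun σ A a b hab => ?_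
  · have := lp.norm_single (E := fun _ : ℕ => 𝕜) hp0 i 1
    rw [hi] at this
    simp at this
  · refine mem_closure_of_tendsto (lp.hasSum_single hp x) (Eventually.of_forall fun A => ?_)
    refine Submodule.sum_mem _ fun i _ => ?_
    have : lp.single p i (x i) = x i • (lp.single p i (1 : 𝕜) : lp (fun _ : ℕ => 𝕜) p) := by
      rw [← lp.single_smul, smul_eq_mul, mul_one]
    rw [this]
    exact Submodule.smul_mem _ _ (Submodule.subset_span ⟨i, rfl⟩)
  · rw [← Real.rpow_le_rpow_iff (norm_nonneg _) (norm_nonneg _) hp',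
      lp.norm_sum_smul_single_perm 𝕜 p hp]
    refine (Finset.sum_le_sum fun i _ => Real.rpow_le_rpow (norm_nonneg _) (hab i) hp'.le).trans ?_
    exact (lp.norm_sum_smul_single_perm 𝕜 p hp 1 A b).ge

end lp

section CZero

variable (𝕜 : Type u) [RCLike 𝕜]

/-- The `i`-th unit vector of `c₀`. -/
noncomputable def czeroSingle (i : ℕ) : C₀(ℕ, 𝕜) where
  toFun := Pi.single i 1
  continuous_toFun := continuous_of_discreteTopology
  zero_at_infty' := by
    rw [Filter.cocompact_eq_cofinite]
    refine tendsto_const_nhds.congr' ?_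
    have : ∀ᶠ j in cofinite, j ≠ i := by simp [Filter.eventually_cofinite]
    filter_upwards [this] with j hj
    rw [Pi.single_eq_of_ne hj]

variable {𝕜}

theorem czero_norm_le {x : C₀(ℕ, 𝕜)} {r : ℝ} (hr : 0 ≤ r) : ‖x‖ ≤ r ↔ ∀ j, ‖x j‖ ≤ r := by
  rw [← ZeroAtInftyContinuousMap.norm_toBCF_eq_norm]
  exact BoundedContinuousFunction.norm_le hr

theorem czero_sum_apply (σ : Equiv.Perm ℕ) (A : Finset ℕ) (a : ℕ → 𝕜) (j : ℕ) :
    (∑ i ∈ A, a i • czeroSingle 𝕜 (σ i)) j = if σ.symm j ∈ A then a (σ.symm j) else 0 := by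
  have h1 : (∑ i ∈ A, a i • czeroSingle 𝕜 (σ i)) j = ∑ i ∈ A, (a i • czeroSingle 𝕜 (σ i)) j :=
    map_sum (⟨⟨fun x : C₀(ℕ, 𝕜) => x j, rfl⟩, fun _ _ => rfl⟩ : C₀(ℕ, 𝕜) →+ 𝕜) _ _
  rw [h1, ← Finset.sum_ite_eq A (σ.symm j) a]
  refine Finset.sum_congr rfl fun i _ => ?_
  have h2 : (a i • czeroSingle 𝕜 (σ i)) j = a i * (Pi.single (σ i) (1 : 𝕜) : ℕ → 𝕜) j := rfl
  rw [h2, Pi.single_apply, mul_ite, mul_one, mul_zero]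
  exact if_congr (Equiv.symm_apply_eq σ).symm rfl rfl

theorem czero_isSymmetricSystem : IsSymmetricSystem 𝕜 (czeroSingle 𝕜) := by
  refine IsSymmetricSystem.of_norm_sum_le (fun i hi => ?_) (fun x => ?_) fun σ A a b hab => ?_
  · have h1 : (czeroSingle 𝕜 i) i = 1 := Pi.single_eq_same i 1
    rw [hi] at h1
    exact zero_ne_one h1
  · rw [Metric.mem_closure_iff]
    intro ε hε
    have hx : Tendsto x cofinite (𝓝 0) := by
      rw [← Filter.cocompact_eq_cofinite]; exact x.zero_at_infty'
    have hfin : {j | ¬ ‖x j‖ < ε / 2}.Finite := by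
      have := (hx.norm.eventually (gt_mem_nhds (show ‖(0 : 𝕜)‖ < ε / 2 by simpa using hε)))
      exact Filter.eventually_cofinite.1 this
    refine ⟨∑ i ∈ hfin.toFinset, x i • czeroSingle 𝕜 i, Submodule.sum_mem _ fun i _ =>
      Submodule.smul_mem _ _ (Submodule.subset_span ⟨i, rfl⟩), ?_⟩
    rw [dist_eq_norm]
    refine lt_of_le_of_lt ((czero_norm_le (half_pos hε).le).2 fun j => ?_) (half_lt_self hε)
    rw [ZeroAtInftyContinuousMap.sub_apply]
    have h1 : (∑ i ∈ hfin.toFinset, x i • czeroSingle 𝕜 i) j =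
        if j ∈ hfin.toFinset then x j else 0 := czero_sum_apply 1 hfin.toFinset x j
    rw [h1]
    by_cases hj : ‖x j‖ < ε / 2
    · rw [if_neg (by simpa using! hj), sub_zero]; exact hj.le
    · rw [if_pos (by simpa using! hj)]
      rw [sub_self, norm_zero]; exact (half_pos hε).le
  · refine (czero_norm_le (norm_nonneg _)).2 fun j => ?_
    rw [czero_sum_apply]
    split_ifs with hj
    · refine (hab _).trans ?_
      have h1 := (czero_norm_le (norm_nonneg (∑ i ∈ A, b i • czeroSingle 𝕜 i))).1 le_rfl (σ.symm j)
      have h2 : (∑ i ∈ A, b i • czeroSingle 𝕜 i) (σ.symm j) =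
          if σ.symm j ∈ A then b (σ.symm j) else 0 := czero_sum_apply 1 A b (σ.symm j)
      rw [h2, if_pos hj] at h1
      exact h1
    · rw [norm_zero]; exact norm_nonneg _

end CZero

/-! ### Passing from a complemented subspace to the whole space -/

section transfer

variable {𝕜 : Type u} [RCLike 𝕜]

theorem IsNowhereDense.preimage_of_rightInverse {Y Z : Type*} [NormedAddCommGroup Y]
    [NormedSpace 𝕜 Y] [NormedAddCommGroup Z] [NormedSpace 𝕜 Z] (i : Y →L[𝕜] Z) (q : Z →L[𝕜] Y)
    (hqi : ∀ y, q (i y) = y) {s : Set Y} (hs : IsNowhereDense s) : IsNowhereDense (q ⁻¹' s) := by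
  rw [IsNowhereDense, Set.eq_empty_iff_forall_notMem] at hs ⊢
  intro z hz
  have h1 : closure (q ⁻¹' s) ⊆ q ⁻¹' closure s :=
    closure_minimal (Set.preimage_mono subset_closure) (isClosed_closure.preimage q.continuous)
  refine hs (q z) (mem_interior_iff_mem_nhds.2 ?_)
  -- This continuous map is a local section of `q` through `z`, so it pulls a neighbourhood of `z`
  -- back to one of `q z`.
  have hcont : Tendsto (fun y => z + i (y - q z)) (𝓝 (q z)) (𝓝 z) := by
    have : ContinuousAt (fun y => z + i (y - q z)) (q z) := by fun_prop
    simpa [ContinuousAt] using this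
  filter_upwards [hcont (mem_interior_iff_mem_nhds.1 hz)] with y hy
  have := h1 hy
  simpa [hqi] using this

theorem AdmitsMachineOperator.of_complemented {Y : Type*} {Z : Type*} [NormedAddCommGroup Y]
    [NormedSpace 𝕜 Y] [NormedAddCommGroup Z] [NormedSpace 𝕜 Z] (i : Y →L[𝕜] Z) (q : Z →L[𝕜] Y)
    (hqi : ∀ y, q (i y) = y) (h : AdmitsMachineOperator 𝕜 Y) : AdmitsMachineOperator 𝕜 Z := by
  obtain ⟨R, hne, hnd, hrec⟩ := h
  -- `R` on the copy of `Y`, the identity on `ker q`: orbits in `Z` differ from embedded orbits of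
  -- `R` by a constant vector, so escape and weak recurrence are both decided by `q z`.
  let S : Z →L[𝕜] Z := i.comp (R.comp q) + (ContinuousLinearMap.id 𝕜 Z - i.comp q)
  have hS : ∀ z, S z = i (R (q z)) + (z - i (q z)) := fun z => rfl
  have hqS : ∀ n z, q ((S ^ n) z) = (R ^ n) (q z) := by
    intro n
    induction n with
    | zero => intro z; simp
    | succ n ih =>
      intro z
      rw [pow_succ, pow_succ, mul_apply_eq_comp, mul_apply_eq_comp, ih, hS]
      simp [hqi]
  have hSn : ∀ n z, (S ^ n) z = i ((R ^ n) (q z)) + (z - i (q z)) := by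
    intro n
    induction n with
    | zero => intro z; simp
    | succ n ih =>
      intro z
      rw [pow_succ', pow_succ', mul_apply_eq_comp, mul_apply_eq_comp, hS, hqS, ih]
      abel
  have hesc : escapingSet S = q ⁻¹' escapingSet R := by
    ext z
    constructor
    · intro hz
      have hz' : Tendsto (fun n => ‖(S ^ n) z‖) atTop atTop := hz
      have h1 : Tendsto (fun n => ‖i‖ * ‖(R ^ n) (q z)‖ + ‖z - i (q z)‖) atTop atTop := by
        refine tendsto_atTop_mono (fun n => ?_) hz'
        rw [hSn]
        exact (norm_add_le _ _).trans (add_le_add_left (i.le_opNorm _) _)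
      have h2 : Tendsto (fun n => ‖i‖ * ‖(R ^ n) (q z)‖) atTop atTop := by
        simpa using tendsto_atTop_add_const_right _ (-‖z - i (q z)‖) h1
      rcases (norm_nonneg i).eq_or_lt with hi | hi
      · simp only [← hi, zero_mul] at h2
        exact (not_tendsto_const_atTop _ _ h2).elim
      · exact (tendsto_const_mul_atTop_of_pos hi).1 h2
    · intro hz
      have hz' : Tendsto (fun n => ‖(R ^ n) (q z)‖) atTop atTop := hz
      have h1 : Tendsto (fun n => ‖q‖ * ‖(S ^ n) z‖) atTop atTop := by
        refine tendsto_atTop_mono (fun n => ?_) hz'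
        rw [← hqS]
        exact q.le_opNorm _
      rcases (norm_nonneg q).eq_or_lt with hi | hi
      · simp only [← hi, zero_mul] at h1
        exact (not_tendsto_const_atTop _ _ h1).elim
      · exact (tendsto_const_mul_atTop_of_pos hi).1 h1
  refine ⟨S, ?_, ?_, fun z hz => ?_⟩
  · rw [hesc]
    obtain ⟨y, hy⟩ := hne
    exact ⟨i y, by rwa [Set.mem_preimage, hqi]⟩
  · rw [hesc]
    exact hnd.preimage_of_rightInverse i q hqi
  · rw [hesc] at hz
    obtain ⟨φ, hφ, hlim⟩ := hrec (q z) hz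
    refine ⟨φ, hφ, ?_⟩
    have h1 := (((WeakSpace.map i).continuous.tendsto _).comp hlim).add_const
      (toWeakSpace 𝕜 Z (z - i (q z)))
    have e1 : WeakSpace.map i (toWeakSpace 𝕜 Y (q z)) + toWeakSpace 𝕜 Z (z - i (q z)) =
        toWeakSpace 𝕜 Z z := by
      change toWeakSpace 𝕜 Z (i (q z)) + _ = _
      rw [← map_add, add_sub_cancel]
    rw [e1] at h1
    refine h1.congr fun k => ?_
    rw [hSn, map_add]
    rfl

theorem AdmitsMachineOperator.of_closedComplemented {Y' : Type*} {Z : Type*}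
    [NormedAddCommGroup Y'] [NormedSpace 𝕜 Y'] [NormedAddCommGroup Z] [NormedSpace 𝕜 Z]
    {Y : Submodule 𝕜 Z} (hY : Y.ClosedComplemented) (e : Y ≃L[𝕜] Y')
    (h : AdmitsMachineOperator 𝕜 Y') : AdmitsMachineOperator 𝕜 Z := by
  obtain ⟨q, hq⟩ := hY
  refine h.of_complemented (Y.subtypeL.comp (e.symm : Y' →L[𝕜] Y)) ((e : Y →L[𝕜] Y').comp q)
    fun y => ?_
  simp [hq]

end transfer

/-! ### Conclusions -/

theorem HasSymmetricBasis.admitsMachineOperator {𝕜 : Type u} {X : Type v} [RCLike 𝕜]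
    [NormedAddCommGroup X] [NormedSpace 𝕜 X] [CompleteSpace X] (h : HasSymmetricBasis 𝕜 X) :
    AdmitsMachineOperator 𝕜 X := by
  obtain ⟨e, he⟩ := h
  exact he.isSymmetricSystem.admitsMachineOperator

theorem AdmitsMachineOperator.not_prajituraConjecture {𝕜 : Type u} {X : Type u} [RCLike 𝕜]
    [NormedAddCommGroup X] [NormedSpace 𝕜 X] [CompleteSpace X] (h : AdmitsMachineOperator 𝕜 X) :
    ¬ PrajituraConjecture 𝕜 := by
  intro hP
  obtain ⟨R, hne, hnd, -⟩ := h
  have hd := hP X R hne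
  rw [IsNowhereDense, hd.closure_eq, interior_univ] at hnd
  exact Set.univ_nonempty.ne_empty hnd

theorem mainTheorem2 (𝕜 : Type u) [RCLike 𝕜] :
    (∀ (X : Type v) [NormedAddCommGroup X] [NormedSpace 𝕜 X] [CompleteSpace X],
      HasSymmetricBasis 𝕜 X → AdmitsMachineOperator 𝕜 X) ∧
    (∀ (Z : Type v) [NormedAddCommGroup Z] [NormedSpace 𝕜 Z] [CompleteSpace Z]
      (Y : Submodule 𝕜 Z), Y.ClosedComplemented → HasSymmetricBasis 𝕜 Y →
        AdmitsMachineOperator 𝕜 Z) ∧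
    (∀ (Z : Type v) [NormedAddCommGroup Z] [NormedSpace 𝕜 Z] [CompleteSpace Z]
      (Y : Submodule 𝕜 Z), Y.ClosedComplemented → Nonempty (Y ≃L[𝕜] C₀(ℕ, 𝕜)) →
        AdmitsMachineOperator 𝕜 Z) ∧
    (∀ (p : ℝ≥0∞) [Fact (1 ≤ p)], p ≠ ∞ →
      ∀ (Z : Type v) [NormedAddCommGroup Z] [NormedSpace 𝕜 Z] [CompleteSpace Z]
        (Y : Submodule 𝕜 Z), Y.ClosedComplemented →
          Nonempty (Y ≃L[𝕜] lp (fun _ : ℕ => 𝕜) p) → AdmitsMachineOperator 𝕜 Z) ∧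
    ¬ PrajituraConjecture 𝕜 := by
  refine ⟨?_, ?_, ?_, ?_, ?_⟩
  · intro X _ _ _ h
    exact h.admitsMachineOperator
  · intro Z _ _ _ Y hY h
    have := hY.isClosed.completeSpace_coe
    exact h.admitsMachineOperator.of_closedComplemented hY (ContinuousLinearEquiv.refl 𝕜 Y)
  · rintro Z _ _ _ Y hY ⟨e⟩
    exact czero_isSymmetricSystem.admitsMachineOperator.of_closedComplemented hY e
  · rintro p _ hp Z _ _ _ Y hY ⟨e⟩
    exact (lp.isSymmetricSystem 𝕜 p hp).admitsMachineOperator.of_closedComplemented hY e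
  -- `ℓ_1` over `𝕜` lies in the universe of `𝕜`, as the conjecture's statement demands.
  · exact (lp.isSymmetricSystem 𝕜 1 ENNReal.one_ne_top).admitsMachineOperator.not_prajituraConjecture
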